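/- Let $d\ge 1$, $\tau>0$, and let $\mathcal{H}=L^2([-\tau,0);\mathbb{R}^d)\times\mathbb{R}^d$ carry the inner product $$\langle (f_1,\gamma_1),(f_2,\gamma_2)\rangle_{\mathcal H}=\frac1\tau\int_{-\tau}^0\langle f_1(\theta),f_2(\theta)\rangle\,d\theta+\langle\gamma_1,\gamma_2\rangle .$$ Let $L_S,B:\mathbb{R}^d\to\mathbb{R}^d$ be linear and $C\in L^2([-\tau,0);\mathbb{R}^{d\times d})$. Let $\mathcal{A}$ be the linear operator on $\mathcal H$ with domain $$D(\mathcal{A})=\Big\{(\Psi^D,\Psi^S)\in\mathcal{H}:\ \Psi^D\in H^1([-\tau,0);\mathbb{R}^d),\ \lim_{\theta\to0^-}\Psi^D(\theta)=\Psi^S\Big\}$$ (where $\Psi^D$ is identified with its continuous representative) and $$\mathcal{A}(\Psi^D,\Psi^S)=\Big(\frac{d\Psi^D}{d\theta},\ L_S\Psi^S+B\Psi^D(-\tau)+\int_{-\tau}^0C(s)\Psi^D(s)\,ds\Big).$$ Let $L_n$ be the Legendre polynomials, $K_n(s)=-(1+s)L_n'(s)+(n^2+n+1)L_n(s)$ the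 Koornwinder polynomials, and $K_n^\tau(\theta)=K_n(1+2\theta/\tau)$. For $N\in\mathbb{N}$ let $\mathcal{H}_N\subset D(\mathcal{A})$ be the span of the $Nd$ elements $(K_q^\tau e_r,\,K_q^\tau(0)e_r)$, $0\le q<N$, $1\le r\le d$, where $e_1,\dots,e_d$ is the canonical basis of $\mathbb{R}^d$ (so $\mathcal H_0=\{0\}$). Let $\Pi_N$ be the orthogonal projector of $\mathcal{H}$ onto $\mathcal{H}_N$, $\mathcal{A}_N=\Pi_N\mathcal{A}\Pi_N$ (a bounded operator on $\mathcal{H}$), and $$T_N(t)=e^{\mathcal{A}_Nt}\Pi_N+(I-\Pi_N),\qquad t\ge0 .$$ Put $$\omega=1+\frac1{2\tau}+|L_S|+\frac\tau2|B|^2+\frac\tau4\|C\|_{L^2}^2,\qquad \|C\|_{L^2}^2=\int_{-\tau}^0|C(s)|^2\,ds,$$ where $|\cdot|$ is the operator norm subordinated to the Euclidean norm. Then: 1. $\mathcal{A}$ is the infinitesimal generator of a $C_0$-semigroup on $\mathcal{H}$, and the semigroup $T(t)$ generated by $\mathcal{A}$ satisfies $\|T(t)\|\le e^{\omega t}$ for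 all $t\ge0$. 2. For every $N$, $(T_N(t))_{t\ge0}$ is a $C_0$-semigroup on $\mathcal{H}$ with generator $\mathcal{A}_N$; it leaves $\mathcal{H}_N$ invariant and extends the linear flow $e^{\mathcal{A}_Nt}$ on $\mathcal{H}_N$; and $\|T_N(t)\|\le e^{\omega t}$ for all $t\ge0$. In particular, the bound on $\|T_N(t)\|$ is uniform in $N$, which is the stability condition (A1) with $M=1$. -/

import Mathlib

open MeasureTheory Set Filter Topology
open scoped ContDiff ENNReal

noncomputable section

namespace DelayGalerkin

/-! ### The state space -/

/-- Euclidean space `ℝ^d`. -/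
abbrev Vec (d : ℕ) : Type := EuclideanSpace ℝ (Fin d)

/-- Lebesgue measure on the history interval `[-τ, 0)`. -/
def hist (τ : ℝ) : Measure ℝ := volume.restrict (Ico (-τ) 0)

/-- Lebesgue measure on `[-τ, 0)`, divided by `τ`. -/
def wHist (τ : ℝ) : Measure ℝ := ENNReal.ofReal τ⁻¹ • hist τ

/-- `L²([-τ,0); ℝ^d)` with the inner product `(1/τ) ∫_{-τ}^0 ⟪f, g⟫ dθ`. -/
abbrev HistSpace (τ : ℝ) (d : ℕ) : Type := Lp (Vec d) 2 (wHist τ)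

/-- The Hilbert space `L²([-τ,0); ℝ^d) × ℝ^d` with the inner product
`(1/τ) ∫_{-τ}^0 ⟪f₁, f₂⟫ dθ + ⟪γ₁, γ₂⟫`. For `Ψ` in it, `Ψ.fst` is the history part and
`Ψ.snd` the present state. -/
abbrev State (τ : ℝ) (d : ℕ) : Type := WithLp 2 (HistSpace τ d × Vec d)

/-- `L²([-τ,0); ℝ^{d×d})` for Lebesgue measure; a matrix carries the operator norm subordinated to
the Euclidean norm, so that `‖C‖² = ∫_{-τ}^0 |C(s)|² ds`. -/
abbrev Kern (τ : ℝ) (d : ℕ) : Type := Lp (Vec d →L[ℝ] Vec d) 2 (hist τ)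

/-! ### The linear operator -/

/-- `g` is the weak derivative of `f` on `(-τ, 0)`. As both are square integrable, `f` is in `H¹`
when such a `g` exists. -/
def HasWeakDeriv {τ : ℝ} {d : ℕ} (f g : HistSpace τ d) : Prop :=
  ∀ φ : ℝ → ℝ, ContDiff ℝ ∞ φ → HasCompactSupport φ → tsupport φ ⊆ Ioo (-τ) 0 →
    ∫ θ, deriv φ θ • f θ ∂(hist τ) = -∫ θ, φ θ • g θ ∂(hist τ)

/-- `u` is a representative of the class `f` that is continuous on `[-τ, 0)`. -/
def IsContRep {τ : ℝ} {d : ℕ} (f : HistSpace τ d) (u : ℝ → Vec d) : Prop :=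
  ContinuousOn u (Ico (-τ) 0) ∧ f =ᵐ[hist τ] u

/-- The delay functional `L_D u = B u(-τ) + ∫_{-τ}^0 C(s) u(s) ds`. -/
def delayFunctional {τ : ℝ} {d : ℕ} (B : Vec d →L[ℝ] Vec d) (C : Kern τ d) (u : ℝ → Vec d) :
    Vec d :=
  B (u (-τ)) + ∫ s, C s (u s) ∂(hist τ)

/-- `Ψ` lies in the domain of `𝒜` and `𝒜 Ψ = Φ`: the history part of `Ψ` is in `H¹` and its
continuous representative `u` tends to the present state of `Ψ` at `0⁻`; the history part of `Φ` is
the derivative of that of `Ψ`, and the present state of `Φ` is `L_S Ψ^S + L_D Ψ^D`. -/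
def DelayRel {τ : ℝ} {d : ℕ} (LS B : Vec d →L[ℝ] Vec d) (C : Kern τ d) (Ψ Φ : State τ d) : Prop :=
  HasWeakDeriv Ψ.fst Φ.fst ∧ ∃ u : ℝ → Vec d, IsContRep Ψ.fst u ∧
    Tendsto u (𝓝[<] 0) (𝓝 Ψ.snd) ∧ Φ.snd = LS Ψ.snd + delayFunctional B C u

section helpers

variable {τ : ℝ} {d : ℕ}

theorem ae_wHist (hτ : 0 < τ) : ae (wHist τ) = ae (hist τ) := by
  have h : ENNReal.ofReal τ⁻¹ ≠ 0 := by simpa using hτ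
  exact Measure.ae_ennreal_smul_measure_eq h _

theorem hist_eq (hτ : 0 < τ) : hist τ = ENNReal.ofReal τ • wHist τ := by
  rw [wHist, smul_smul, ← ENNReal.ofReal_mul hτ.le, mul_inv_cancel₀ hτ.ne']
  simp

instance : IsFiniteMeasure (hist τ) := by
  unfold hist; infer_instance

instance : IsFiniteMeasure (wHist τ) := by
  unfold wHist; exact Measure.smul_finite _ ENNReal.ofReal_ne_top

theorem memLp_hist (hτ : 0 < τ) (f : HistSpace τ d) : MemLp f 2 (hist τ) := by
  rw [hist_eq hτ]
  exact (Lp.memLp f).smul_measure ENNReal.ofReal_ne_top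

theorem integrable_hist (hτ : 0 < τ) (f : HistSpace τ d) : Integrable f (hist τ) :=
  (memLp_hist hτ f).integrable (by norm_num)

theorem integrable_smul_hist (hτ : 0 < τ) (f : HistSpace τ d) {φ : ℝ → ℝ} (hφ : Continuous φ)
    (hc : HasCompactSupport φ) : Integrable (fun θ => φ θ • f θ) (hist τ) := by
  obtain ⟨K, hK⟩ := hc.exists_bound_of_continuous hφ
  exact (integrable_hist hτ f).bdd_smul K hφ.aestronglyMeasurable (Eventually.of_forall hK)

theorem integrable_kern (hτ : 0 < τ) (C : Kern τ d) {f : HistSpace τ d} {u : ℝ → Vec d}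
    (h : IsContRep f u) : Integrable (fun s => C s (u s)) (hist τ) := by
  have hu : MemLp u 2 (hist τ) := (memLp_hist hτ f).ae_eq h.2
  have hC : MemLp C 2 (hist τ) := Lp.memLp C
  have h1 : Integrable (fun s => ‖C s‖ * ‖u s‖) (hist τ) := hC.norm.integrable_mul hu.norm
  refine h1.mono ?_ ?_
  · exact (ContinuousLinearMap.id ℝ (Vec d →L[ℝ] Vec d)).aestronglyMeasurable_comp₂
      hC.aestronglyMeasurable hu.aestronglyMeasurable
  · refine Eventually.of_forall fun s => ?_
    simpa using (C s).le_opNorm (u s)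

theorem HasWeakDeriv.add (hτ : 0 < τ) {f g f' g' : HistSpace τ d} (h : HasWeakDeriv f g)
    (h' : HasWeakDeriv f' g') : HasWeakDeriv (f + f') (g + g') := by
  intro φ h1 h2 h3
  have e1 : (f + f' : HistSpace τ d) =ᵐ[hist τ] f + f' := by
    rw [← ae_wHist hτ]; exact Lp.coeFn_add f f'
  have e2 : (g + g' : HistSpace τ d) =ᵐ[hist τ] g + g' := by
    rw [← ae_wHist hτ]; exact Lp.coeFn_add g g'
  have hd : Continuous (deriv φ) := h1.continuous_deriv (by simp)
  have i1 : ∫ θ, deriv φ θ • (f + f' : HistSpace τ d) θ ∂(hist τ)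
      = ∫ θ, (deriv φ θ • f θ + deriv φ θ • f' θ) ∂(hist τ) := by
    refine integral_congr_ae ?_
    filter_upwards [e1] with θ hθ
    rw [hθ, Pi.add_apply, smul_add]
  have i2 : ∫ θ, φ θ • (g + g' : HistSpace τ d) θ ∂(hist τ)
      = ∫ θ, (φ θ • g θ + φ θ • g' θ) ∂(hist τ) := by
    refine integral_congr_ae ?_
    filter_upwards [e2] with θ hθ
    rw [hθ, Pi.add_apply, smul_add]
  rw [i1, i2, integral_add (integrable_smul_hist hτ f hd h2.deriv)
    (integrable_smul_hist hτ f' hd h2.deriv), integral_add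
    (integrable_smul_hist hτ g h1.continuous h2) (integrable_smul_hist hτ g' h1.continuous h2),
    h φ h1 h2 h3, h' φ h1 h2 h3, neg_add]

theorem HasWeakDeriv.smul (hτ : 0 < τ) {f g : HistSpace τ d} (c : ℝ) (h : HasWeakDeriv f g) :
    HasWeakDeriv (c • f) (c • g) := by
  intro φ h1 h2 h3
  have e1 : (c • f : HistSpace τ d) =ᵐ[hist τ] c • f := by
    rw [← ae_wHist hτ]; exact Lp.coeFn_smul c f
  have e2 : (c • g : HistSpace τ d) =ᵐ[hist τ] c • g := by
    rw [← ae_wHist hτ]; exact Lp.coeFn_smul c g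
  have i1 : ∫ θ, deriv φ θ • (c • f : HistSpace τ d) θ ∂(hist τ)
      = ∫ θ, c • (deriv φ θ • f θ) ∂(hist τ) := by
    refine integral_congr_ae ?_
    filter_upwards [e1] with θ hθ
    rw [hθ, Pi.smul_apply, smul_comm]
  have i2 : ∫ θ, φ θ • (c • g : HistSpace τ d) θ ∂(hist τ)
      = ∫ θ, c • (φ θ • g θ) ∂(hist τ) := by
    refine integral_congr_ae ?_
    filter_upwards [e2] with θ hθ
    rw [hθ, Pi.smul_apply, smul_comm]
  rw [i1, i2, integral_smul, integral_smul, h φ h1 h2 h3, smul_neg]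

theorem weakDeriv_zero (hτ : 0 < τ) {g : HistSpace τ d} (h : HasWeakDeriv 0 g) : g = 0 := by
  have h0 : ((0 : HistSpace τ d) : ℝ → Vec d) =ᵐ[hist τ] 0 := by
    rw [← ae_wHist hτ]; exact Lp.coeFn_zero _ _ _
  have key := isOpen_Ioo.ae_eq_zero_of_integral_contDiff_smul_eq_zero (μ := hist τ)
    (U := Ioo (-τ) 0) (f := g) ((integrable_hist hτ g).locallyIntegrable.locallyIntegrableOn _) (by
      intro φ h1 h2 h3
      have := h φ h1 h2 h3
      have z : ∫ θ, deriv φ θ • (0 : HistSpace τ d) θ ∂(hist τ) = 0 := by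
        rw [← integral_zero ℝ (Vec d) (μ := hist τ)]
        refine integral_congr_ae ?_
        filter_upwards [h0] with θ hθ
        rw [hθ, Pi.zero_apply, smul_zero]
      rw [z] at this
      simpa using this.symm)
  have m : ∀ᵐ θ ∂(hist τ), θ ∈ Ioo (-τ) 0 := by
    rw [hist, Measure.restrict_congr_set Ioo_ae_eq_Ico.symm]
    exact ae_restrict_mem measurableSet_Ioo
  rw [Lp.eq_zero_iff_ae_eq_zero, EventuallyEq, ae_wHist hτ]
  filter_upwards [key, m] with θ a b using a b

theorem contRep_zero (hτ : 0 < τ) {u : ℝ → Vec d} (h : IsContRep (0 : HistSpace τ d) u) :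
    ∀ θ ∈ Ico (-τ) 0, u θ = 0 := by
  have h0 : ((0 : HistSpace τ d) : ℝ → Vec d) =ᵐ[hist τ] 0 := by
    rw [← ae_wHist hτ]; exact Lp.coeFn_zero _ _ _
  have h1 : u =ᵐ[volume.restrict (Ico (-τ) 0)] 0 := h.2.symm.trans h0
  exact Measure.eqOn_Ico_of_ae_eq volume h1 h.1 continuousOn_const

end helpers

/-- The graph of `𝒜`. -/
def delayGraph {τ : ℝ} (hτ : 0 < τ) {d : ℕ} (LS B : Vec d →L[ℝ] Vec d) (C : Kern τ d) :
    Submodule ℝ (State τ d × State τ d) where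
  carrier := {p | DelayRel LS B C p.1 p.2}
  zero_mem' := by
    have h0 : ((0 : HistSpace τ d) : ℝ → Vec d) =ᵐ[hist τ] 0 := by
      rw [← ae_wHist hτ]; exact Lp.coeFn_zero _ _ _
    refine ⟨?_, 0, ⟨continuousOn_const, h0⟩, tendsto_const_nhds, ?_⟩
    · have h : HasWeakDeriv (0 : HistSpace τ d) 0 := by
        intro φ _ _ _
        have z : ∀ ψ : ℝ → ℝ, ∫ θ, ψ θ • (0 : HistSpace τ d) θ ∂(hist τ) = 0 := fun ψ => by
          rw [← integral_zero ℝ (Vec d) (μ := hist τ)]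
          refine integral_congr_ae ?_
          filter_upwards [h0] with θ hθ
          rw [hθ, Pi.zero_apply, smul_zero]
        rw [z, z, neg_zero]
      exact h
    · simp [delayFunctional]
  add_mem' := by
    rintro ⟨Ψ, Φ⟩ ⟨Ψ', Φ'⟩ ⟨w, u, hu, hl, he⟩ ⟨w', u', hu', hl', he'⟩
    have e1 : (Ψ.fst + Ψ'.fst : HistSpace τ d) =ᵐ[hist τ] Ψ.fst + Ψ'.fst := by
      rw [← ae_wHist hτ]; exact Lp.coeFn_add _ _
    refine ⟨w.add hτ w', u + u', ⟨hu.1.add hu'.1, e1.trans (hu.2.add hu'.2)⟩, hl.add hl', ?_⟩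
    have i := integral_add (integrable_kern hτ C hu) (integrable_kern hτ C hu')
    simp only [Prod.mk_add_mk, WithLp.add_snd, he, he', delayFunctional, Pi.add_apply, map_add, i]
    abel
  smul_mem' := by
    rintro c ⟨Ψ, Φ⟩ ⟨w, u, hu, hl, he⟩
    have e1 : (c • Ψ.fst : HistSpace τ d) =ᵐ[hist τ] c • Ψ.fst := by
      rw [← ae_wHist hτ]; exact Lp.coeFn_smul _ _
    refine ⟨w.smul hτ c, c • u, ⟨hu.1.const_smul c, e1.trans (hu.2.const_smul c)⟩,
      hl.const_smul c, ?_⟩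
    have i := integral_smul (μ := hist τ) c (fun s => C s (u s))
    simp only [Prod.smul_mk, WithLp.smul_snd, he, delayFunctional, Pi.smul_apply, map_smul, i,
      smul_add]

/-- The linear operator `𝒜`, with domain
`{Ψ : Ψ^D ∈ H¹([-τ,0); ℝ^d), lim_{θ → 0⁻} Ψ^D(θ) = Ψ^S}`. -/
def delayOp {τ : ℝ} (hτ : 0 < τ) {d : ℕ} (LS B : Vec d →L[ℝ] Vec d) (C : Kern τ d) :
    State τ d →ₗ.[ℝ] State τ d :=
  (delayGraph hτ LS B C).toLinearPMap

theorem delayGraph_single {τ : ℝ} (hτ : 0 < τ) {d : ℕ} (LS B : Vec d →L[ℝ] Vec d) (C : Kern τ d) :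
    ∀ p ∈ delayGraph hτ LS B C, p.1 = 0 → p.2 = 0 := by
  rintro ⟨Ψ, Φ⟩ ⟨w, u, hu, hl, he⟩ (rfl : Ψ = 0)
  have h1 : Φ.fst = 0 := weakDeriv_zero hτ w
  have hz : ∀ θ ∈ Ico (-τ) 0, u θ = 0 := contRep_zero hτ hu
  have h2 : Φ.snd = 0 := by
    have i : ∫ s, C s (u s) ∂(hist τ) = 0 := by
      rw [← integral_zero ℝ (Vec d) (μ := hist τ)]
      refine integral_congr_ae ?_
      filter_upwards [ae_restrict_mem measurableSet_Ico] with s hs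
      simp [hz s hs]
    simp only at he
    rw [he, delayFunctional, hz (-τ) ⟨le_rfl, by linarith⟩, i]
    simp
  exact (WithLp.ofLp_injective 2) (Prod.ext h1 h2)

theorem mem_delayOp_graph {τ : ℝ} (hτ : 0 < τ) {d : ℕ} (LS B : Vec d →L[ℝ] Vec d) (C : Kern τ d)
    (Ψ Φ : State τ d) : (Ψ, Φ) ∈ (delayOp hτ LS B C).graph ↔ DelayRel LS B C Ψ Φ := by
  rw [delayOp, Submodule.toLinearPMap_graph_eq _ (fun p hp => delayGraph_single hτ LS B C p hp)]
  rfl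

/-! ### Koornwinder polynomials and the Galerkin subspaces -/

/-- The Legendre polynomial `L_n = (1 / (2^n n!)) dⁿ/dsⁿ (s² - 1)ⁿ`. -/
def legendre (n : ℕ) : Polynomial ℝ :=
  Polynomial.C (1 / (2 ^ n * (n.factorial : ℝ))) *
    (Polynomial.derivative)^[n] ((Polynomial.X ^ 2 - 1) ^ n)

/-- The Koornwinder polynomial `K_n(s) = -(1 + s) L_n'(s) + (n² + n + 1) L_n(s)`. -/
def koornwinder (n : ℕ) : Polynomial ℝ :=
  -(1 + Polynomial.X) * Polynomial.derivative (legendre n) +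
    Polynomial.C ((n : ℝ) ^ 2 + n + 1) * legendre n

/-- The rescaled Koornwinder polynomial `K_n^τ(θ) = K_n(1 + 2θ/τ)`. -/
def rescaledKoornwinder (τ : ℝ) (n : ℕ) (θ : ℝ) : ℝ := (koornwinder n).eval (1 + 2 * θ / τ)

/-- The vectorized polynomial: its entry of index `r` is `K_q^τ(θ)`, the others vanish. -/
def vecKoornwinder (τ : ℝ) {d : ℕ} (q : ℕ) (r : Fin d) (θ : ℝ) : Vec d :=
  EuclideanSpace.single r (rescaledKoornwinder τ q θ)

theorem contDiff_rescaledKoornwinder (τ : ℝ) (n : ℕ) :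
    ContDiff ℝ ∞ (rescaledKoornwinder τ n) := by
  unfold rescaledKoornwinder
  have h : ContDiff ℝ ∞ (fun θ : ℝ => 1 + 2 * θ / τ) := by fun_prop
  have hp : ContDiff ℝ ∞ (fun s : ℝ => (koornwinder n).eval s) := by
    simpa using (koornwinder n).contDiff_aeval (𝕜 := ℝ) ∞
  exact hp.comp h

theorem vecKoornwinder_eq (τ : ℝ) {d : ℕ} (q : ℕ) (r : Fin d) (θ : ℝ) :
    vecKoornwinder τ q r θ = rescaledKoornwinder τ q θ • EuclideanSpace.single r (1 : ℝ) := by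
  ext i; simp [vecKoornwinder]

theorem contDiff_vecKoornwinder (τ : ℝ) {d : ℕ} (q : ℕ) (r : Fin d) :
    ContDiff ℝ ∞ (vecKoornwinder τ q r) := by
  have : vecKoornwinder τ q r
      = fun θ => rescaledKoornwinder τ q θ • EuclideanSpace.single r (1 : ℝ) :=
    funext (vecKoornwinder_eq τ q r)
  rw [this]
  exact (contDiff_rescaledKoornwinder τ q).smul contDiff_const

theorem memLp_of_continuous (τ : ℝ) {d : ℕ} {u : ℝ → Vec d} (hu : Continuous u) :
    MemLp u 2 (wHist τ) := by
  obtain ⟨K, hK⟩ := (isCompact_Icc (a := -τ) (b := 0)).exists_bound_of_continuousOn hu.continuousOn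
  refine MemLp.of_bound hu.aestronglyMeasurable K ?_
  have h : ∀ᵐ θ ∂(hist τ), ‖u θ‖ ≤ K := by
    filter_upwards [ae_restrict_mem measurableSet_Ico] with s hs
    exact hK s (Ico_subset_Icc_self hs)
  exact Measure.ae_smul_measure h _

/-- The basis element `(𝐊, 𝐊(0))` of the state space for the vectorized polynomial `𝐊` of
index `(q, r)`. -/
def basisElt (τ : ℝ) {d : ℕ} (q : ℕ) (r : Fin d) : State τ d :=
  WithLp.toLp 2 ((memLp_of_continuous τ (contDiff_vecKoornwinder τ q r).continuous).toLp _,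
    vecKoornwinder τ q r 0)

/-- The subspace `ℋ_N`, spanned by the first `N d` vectorized polynomials: those of degree less
than `N`, in each of the `d` coordinates. -/
def galerkinSpace (τ : ℝ) (d N : ℕ) : Submodule ℝ (State τ d) :=
  Submodule.span ℝ (range fun p : Fin N × Fin d => basisElt τ (p.1 : ℕ) p.2)

instance galerkinSpace_finite (τ : ℝ) (d N : ℕ) : FiniteDimensional ℝ (galerkinSpace τ d N) :=
  FiniteDimensional.span_of_finite ℝ (finite_range _)

theorem hasWeakDeriv_of_contDiff {τ : ℝ} (hτ : 0 < τ) {d : ℕ} {u : ℝ → Vec d}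
    (hu : ContDiff ℝ ∞ u) :
    HasWeakDeriv ((memLp_of_continuous τ hu.continuous).toLp u)
      ((memLp_of_continuous τ (hu.continuous_deriv (by simp))).toLp (deriv u)) := by
  intro φ h1 h2 h3
  have e1 := (memLp_of_continuous τ hu.continuous).coeFn_toLp
  have e2 := (memLp_of_continuous τ (hu.continuous_deriv (by simp))).coeFn_toLp
  rw [EventuallyEq, ae_wHist hτ] at e1 e2
  have i1 : ∫ θ, deriv φ θ • ((memLp_of_continuous τ hu.continuous).toLp u) θ ∂(hist τ)
      = ∫ θ, deriv φ θ • u θ ∂(hist τ) := by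
    refine integral_congr_ae ?_
    filter_upwards [e1] with θ hθ
    rw [hθ]
  have i2 : ∫ θ, φ θ • ((memLp_of_continuous τ (hu.continuous_deriv (by simp))).toLp (deriv u)) θ
      ∂(hist τ) = ∫ θ, φ θ • deriv u θ ∂(hist τ) := by
    refine integral_congr_ae ?_
    filter_upwards [e2] with θ hθ
    rw [hθ]
  rw [i1, i2, hist, integral_Ico_eq_integral_Ioc, integral_Ico_eq_integral_Ioc,
    ← intervalIntegral.integral_of_le (by linarith), ← intervalIntegral.integral_of_le (by linarith),
    eq_neg_iff_add_eq_zero]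
  have cd : Continuous (deriv φ) := h1.continuous_deriv (by simp)
  have cu : Continuous (deriv u) := hu.continuous_deriv (by simp)
  have z1 : φ 0 = 0 := image_eq_zero_of_notMem_tsupport fun h => lt_irrefl _ (h3 h).2
  have z2 : φ (-τ) = 0 := image_eq_zero_of_notMem_tsupport fun h => lt_irrefl _ (h3 h).1
  rw [← intervalIntegral.integral_add
    (f := fun θ => deriv φ θ • u θ) (g := fun θ => φ θ • deriv u θ)
    ((cd.smul hu.continuous).intervalIntegrable _ _) ((h1.continuous.smul cu).intervalIntegrable _ _),
    intervalIntegral.integral_eq_sub_of_hasDerivAt (f := fun θ => φ θ • u θ)]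
  · simp [z1, z2]
  · intro θ _
    rw [add_comm]
    exact ((h1.differentiable (by simp)) θ).hasDerivAt.smul
      ((hu.differentiable (by simp)) θ).hasDerivAt
  · exact ((cd.smul hu.continuous).add (h1.continuous.smul cu)).intervalIntegrable _ _

/-- The Galerkin subspaces lie in the domain of `𝒜`. -/
theorem galerkinSpace_le_domain {τ : ℝ} (hτ : 0 < τ) {d : ℕ} (LS B : Vec d →L[ℝ] Vec d)
    (C : Kern τ d) (N : ℕ) : galerkinSpace τ d N ≤ (delayOp hτ LS B C).domain := by
  refine Submodule.span_le.2 ?_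
  rintro _ ⟨⟨q, r⟩, rfl⟩
  have hu := contDiff_vecKoornwinder τ (q : ℕ) r
  refine LinearPMap.mem_domain_of_mem_graph ((mem_delayOp_graph hτ LS B C _
    (WithLp.toLp 2 ((memLp_of_continuous τ (hu.continuous_deriv (by simp))).toLp
      (deriv (vecKoornwinder τ (q : ℕ) r)),
      LS (vecKoornwinder τ (q : ℕ) r 0) + delayFunctional B C (vecKoornwinder τ (q : ℕ) r)))).2 ?_)
  refine ⟨hasWeakDeriv_of_contDiff hτ hu, vecKoornwinder τ (q : ℕ) r,
    ⟨hu.continuous.continuousOn, ?_⟩, (hu.continuous.tendsto 0).mono_left inf_le_left, rfl⟩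
  rw [← ae_wHist hτ]
  exact (memLp_of_continuous τ hu.continuous).coeFn_toLp

/-- The orthogonal projector `Π_N` onto `ℋ_N`. -/
def galerkinProj (τ : ℝ) (d N : ℕ) : State τ d →L[ℝ] State τ d :=
  (galerkinSpace τ d N).starProjection

/-- `𝒜_N = Π_N 𝒜 Π_N`, a bounded operator on the whole state space, as `ℋ_N` is a
finite-dimensional subspace of the domain of `𝒜`. -/
def galerkinOp {τ : ℝ} (hτ : 0 < τ) {d : ℕ} (LS B : Vec d →L[ℝ] Vec d) (C : Kern τ d) (N : ℕ) :
    State τ d →L[ℝ] State τ d :=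
  galerkinProj τ d N ∘L
    LinearMap.toContinuousLinearMap ((delayOp hτ LS B C).toFun ∘ₗ
      Submodule.inclusion (galerkinSpace_le_domain hτ LS B C N)) ∘L
    (galerkinSpace τ d N).orthogonalProjectionOnto

/-- The extended Galerkin flow `T_N(t) = e^{𝒜_N t} Π_N + (I - Π_N)`. -/
def galerkinFlow {τ : ℝ} (hτ : 0 < τ) {d : ℕ} (LS B : Vec d →L[ℝ] Vec d) (C : Kern τ d) (N : ℕ)
    (t : ℝ) : State τ d →L[ℝ] State τ d :=
  NormedSpace.exp (t • galerkinOp hτ LS B C N) ∘L galerkinProj τ d N +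
    (ContinuousLinearMap.id ℝ (State τ d) - galerkinProj τ d N)

/-- The growth rate
`ω = 1 + 1/(2τ) + |L_S| + (τ/2) |B|² + (τ/4) ‖C‖²_{L²}`. -/
def growthRate (τ : ℝ) {d : ℕ} (LS B : Vec d →L[ℝ] Vec d) (C : Kern τ d) : ℝ :=
  1 + 1 / (2 * τ) + ‖LS‖ + τ / 2 * ‖B‖ ^ 2 + τ / 4 * ‖C‖ ^ 2

/-! ### Strongly continuous semigroups -/

/-- A `C₀`-semigroup `(T(t))_{t ≥ 0}` of bounded operators; values at `t < 0` are irrelevant. -/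
structure IsC0Semigroup {X : Type*} [NormedAddCommGroup X] [NormedSpace ℝ X]
    (T : ℝ → X →L[ℝ] X) : Prop where
  map_zero : T 0 = ContinuousLinearMap.id ℝ X
  map_add : ∀ s t : ℝ, 0 ≤ s → 0 ≤ t → T (s + t) = T s ∘L T t
  tendsto_zero : ∀ x : X, Tendsto (fun t => T t x) (𝓝[>] 0) (𝓝 x)

/-- `L` is the infinitesimal generator of `T`: a vector `x` is in the domain of `L` exactly when
`(T(h) x - x) / h` converges as `h → 0⁺`, and the limit is `L x`. -/
def IsGenerator {X : Type*} [NormedAddCommGroup X] [NormedSpace ℝ X]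
    (T : ℝ → X →L[ℝ] X) (L : X →ₗ.[ℝ] X) : Prop :=
  ∀ x y : X, (x, y) ∈ L.graph ↔ Tendsto (fun h : ℝ => h⁻¹ • (T h x - x)) (𝓝[>] 0) (𝓝 y)

end DelayGalerkin

end

namespace DelayGalerkin

/-! ### Strongly continuous semigroups on Banach and Hilbert spaces -/

section Banach

variable {X : Type*} [NormedAddCommGroup X] [NormedSpace ℝ X]

/-! Everything rests on one inequality, ⟨𝒜Ψ, Ψ⟩ ≤ ω‖Ψ‖² on D(𝒜) (`inner_le_of_delayRel`). With γ =
Ψ^S and u the continuous representative of Ψ^D, the transport part contributes (|γ|² -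
|u(-τ)|²)/(2τ). Young's inequality bounds the point-delay term so that its share of |u(-τ)|² is
exactly cancelled, and bounds the distributed delay by ‖Ψ^D‖² plus a multiple of |γ|². Collecting
coefficients gives ω.

For l > ω the operator l - 𝒜 is onto (`exists_delayRel_resolvent`): variation of constants solves
the history equation for a prescribed value γ at 0, and what remains is a linear equation for γ in
ℝ^d, injective by the same inequality and hence solvable. The Lumer–Phillips theorem then yields the
semigroup; it is proved here by Yosida approximation for graphs in H × H
(`exists_semigroup_of_quasidissipative`). The bound e^{ωt} is Grönwall's inequality for ‖T(t)x‖² on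
the dense domain (`IsC0Semigroup.norm_le_exp`).

The Galerkin operators inherit the inequality because Π_N is self-adjoint: ⟨𝒜_N x, x⟩ = ⟨𝒜Π_N x, Π_N
x⟩ ≤ ω‖x‖². Since 𝒜_N vanishes on the orthogonal complement of ℋ_N, T_N(t) is just e^{t𝒜_N}, and the
same Grönwall argument gives a bound independent of N. All that matters about ℋ_N is that it is a
finite-dimensional subspace of D(𝒜). -/

theorem IsC0Semigroup.tendsto_nhdsGE {T : ℝ → X →L[ℝ] X} (hT : IsC0Semigroup T) (x : X) :
    Tendsto (fun t => T t x) (𝓝[≥] 0) (𝓝 x) := by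
  rw [← Ioi_insert, nhdsWithin_insert, tendsto_sup]
  refine ⟨?_, hT.tendsto_zero x⟩
  rw [tendsto_pure_left]
  intro s hs
  simpa [hT.map_zero] using mem_of_mem_nhds hs

/-- Otherwise there are t_n → 0⁺ with ‖T(t_n)‖ > n, while every orbit sequence T(t_n)x converges and
so is bounded; this contradicts Banach–Steinhaus. -/
theorem IsC0Semigroup.exists_bound_near_zero [CompleteSpace X] {T : ℝ → X →L[ℝ] X}
    (hT : IsC0Semigroup T) : ∃ δ > 0, ∃ M, ∀ t ∈ Icc 0 δ, ‖T t‖ ≤ M := by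
  by_contra! H
  choose t ht hn using fun n : ℕ => H (1 / ((n : ℝ) + 1)) (by positivity) n
  have ht0 : Tendsto t atTop (𝓝[≥] 0) := by
    refine tendsto_nhdsWithin_iff.2 ⟨?_, Eventually.of_forall fun n => (ht n).1⟩
    exact squeeze_zero (fun n => (ht n).1) (fun n => (ht n).2) tendsto_one_div_add_atTop_nhds_zero_nat
  obtain ⟨K, hK⟩ := banach_steinhaus (g := fun n => T (t n)) fun x => by
    obtain ⟨K, hK⟩ := (((hT.tendsto_nhdsGE x).comp ht0).norm).bddAbove_range
    exact ⟨K, fun n => hK ⟨n, rfl⟩⟩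
  obtain ⟨n, hn'⟩ := exists_nat_gt K
  exact absurd (hn n) (not_lt.2 ((hK n).trans hn'.le))

theorem IsC0Semigroup.exists_bound [CompleteSpace X] {T : ℝ → X →L[ℝ] X}
    (hT : IsC0Semigroup T) (b : ℝ) : ∃ M, ∀ t ∈ Icc 0 b, ‖T t‖ ≤ M := by
  obtain ⟨δ, hδ, M, hM⟩ := hT.exists_bound_near_zero
  have key : ∀ k : ℕ, ∃ K, ∀ t ∈ Icc 0 (k * δ), ‖T t‖ ≤ K := by
    intro k
    induction k with
    | zero => exact ⟨M, fun t ht => hM t ⟨ht.1, ht.2.trans (by simpa using hδ.le)⟩⟩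
    | succ k ih =>
      obtain ⟨K, hK⟩ := ih
      refine ⟨max K (K * M), fun t ht => ?_⟩
      rcases le_or_gt t (k * δ) with h | h
      · exact (hK t ⟨ht.1, h⟩).trans (le_max_left _ _)
      · have hk : 0 ≤ k * δ := by positivity
        have h2 : t - k * δ ≤ δ := by have := ht.2; push_cast at this; linarith
        have e : T t = T (k * δ) ∘L T (t - k * δ) := by
          rw [← hT.map_add _ _ hk (by linarith)]; congr 1; ring
        rw [e]
        refine le_max_of_le_right ((ContinuousLinearMap.opNorm_comp_le _ _).trans ?_)
        have h0 := hK _ ⟨hk, le_rfl⟩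
        exact mul_le_mul h0 (hM _ ⟨by linarith, h2⟩) (norm_nonneg _) ((norm_nonneg _).trans h0)
  obtain ⟨k, hk⟩ := exists_nat_gt (b / δ)
  obtain ⟨K, hK⟩ := key k
  exact ⟨K, fun t ht => hK t ⟨ht.1, ht.2.trans ((div_lt_iff₀ hδ).1 hk).le⟩⟩

/-- On either side of t the increment factors as T(a)(T(b - a)x - x) with a = min s t. Since a ≤ t,
the bound of ‖T‖ on [0, t] suffices. -/
theorem IsC0Semigroup.continuousOn [CompleteSpace X] {T : ℝ → X →L[ℝ] X}
    (hT : IsC0Semigroup T) (x : X) : ContinuousOn (fun t => T t x) (Ici 0) := by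
  intro t ht
  have ht : 0 ≤ t := ht
  obtain ⟨M, hM⟩ := hT.exists_bound t
  have hlim : Tendsto (fun s => M * ‖T |s - t| x - x‖) (𝓝[≥] t ⊔ 𝓝[Icc 0 t] t) (𝓝 0) := by
    have h1 : Tendsto (fun s => |s - t|) (𝓝 t) (𝓝[≥] 0) := by
      refine tendsto_nhdsWithin_iff.2 ⟨?_, Eventually.of_forall fun s => abs_nonneg (s - t)⟩
      have : Continuous fun s : ℝ => |s - t| := by fun_prop
      simpa using this.tendsto t
    have h2 := (((hT.tendsto_nhdsGE x).comp h1).sub_const x).norm.const_mul M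
    simp only [sub_self, norm_zero, mul_zero] at h2
    exact h2.mono_left (sup_le inf_le_left inf_le_left)
  have hs : Ici (0 : ℝ) = Ici t ∪ Icc 0 t := by
    ext s; simp only [mem_Ici, mem_union, mem_Icc]
    constructor
    · intro h; rcases le_total t s with h' | h'
      · exact Or.inl h'
      · exact Or.inr ⟨h, h'⟩
    · rintro (h | h)
      · exact ht.trans h
      · exact h.1
  rw [ContinuousWithinAt, hs, nhdsWithin_union, tendsto_iff_norm_sub_tendsto_zero]
  refine squeeze_zero' (Eventually.of_forall fun s => norm_nonneg _) ?_ hlim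
  rw [← nhdsWithin_union, ← hs]
  filter_upwards [self_mem_nhdsWithin] with s hs0
  have hs0 : 0 ≤ s := hs0
  have key : ∀ a b : ℝ, 0 ≤ a → a ≤ t → a ≤ b → ‖T b x - T a x‖ ≤ M * ‖T (b - a) x - x‖ := by
    intro a b ha hat hab
    have e : T b x = T a (T (b - a) x) := by
      have := hT.map_add a (b - a) ha (by linarith)
      rw [add_sub_cancel] at this
      rw [this]; rfl
    rw [e, ← map_sub]
    exact (T a).le_of_opNorm_le (hM a ⟨ha, hat⟩) _
  rcases le_total t s with h | h
  · rw [abs_of_nonneg (by linarith)]; exact key t s ht le_rfl h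
  · rw [abs_sub_comm, abs_of_nonneg (by linarith), norm_sub_rev]; exact key s t hs0 h h

/-- The orbit of a vector in the domain of the generator stays there, and is right differentiable. -/
theorem IsC0Semigroup.hasDerivWithinAt {T : ℝ → X →L[ℝ] X} (hT : IsC0Semigroup T)
    {x y : X} (h : Tendsto (fun h : ℝ => h⁻¹ • (T h x - x)) (𝓝[>] 0) (𝓝 y)) {t : ℝ} (ht : 0 ≤ t) :
    Tendsto (fun h : ℝ => h⁻¹ • (T h (T t x) - T t x)) (𝓝[>] 0) (𝓝 (T t y)) ∧
      HasDerivWithinAt (fun s => T s x) (T t y) (Ici t) t := by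
  have h1 : Tendsto (fun h : ℝ => h⁻¹ • (T h (T t x) - T t x)) (𝓝[>] 0) (𝓝 (T t y)) := by
    refine (((T t).continuous.tendsto y).comp h).congr' ?_
    filter_upwards [self_mem_nhdsWithin] with s hs
    have hs : 0 < s := hs
    have e : T t (T s x) = T s (T t x) := by
      rw [← ContinuousLinearMap.comp_apply, ← ContinuousLinearMap.comp_apply,
        ← hT.map_add _ _ ht hs.le, ← hT.map_add _ _ hs.le ht, add_comm]
    simp [e]
  refine ⟨h1, ?_⟩
  rw [← hasDerivWithinAt_Ioi_iff_Ici, hasDerivWithinAt_iff_tendsto_slope' (by simp)]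
  have h2 : Tendsto (fun s => s - t) (𝓝[>] t) (𝓝[>] 0) := by
    refine tendsto_nhdsWithin_iff.2 ⟨?_, ?_⟩
    · have : Continuous fun s : ℝ => s - t := by fun_prop
      exact (this.tendsto' t 0 (sub_self t)).mono_left inf_le_left
    · filter_upwards [self_mem_nhdsWithin] with s hs using sub_pos.2 (mem_Ioi.1 hs)
  refine (h1.comp h2).congr' ?_
  filter_upwards [self_mem_nhdsWithin] with s hs
  have hs : t < s := hs
  have e : T s x = T (s - t) (T t x) := by
    rw [← ContinuousLinearMap.comp_apply, ← hT.map_add _ _ (by linarith) ht, sub_add_cancel]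
  simp [slope_def_module, e]

variable [CompleteSpace X]

theorem hasDerivAt_exp_smul_apply (A : X →L[ℝ] X) (x : X) (t : ℝ) :
    HasDerivAt (fun s : ℝ => NormedSpace.exp (s • A) x) (NormedSpace.exp (t • A) (A x)) t := by
  have h := (hasDerivAt_exp_smul_const (𝕂 := ℝ) A t).clm_apply (hasDerivAt_const t x)
  simpa using h

theorem isC0Semigroup_exp (A : X →L[ℝ] X) : IsC0Semigroup fun t => NormedSpace.exp (t • A) where
  map_zero := by simp [ContinuousLinearMap.one_def]
  map_add s t _ _ := by
    let := NormedAlgebra.restrictScalars ℚ ℝ (X →L[ℝ] X)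
    rw [add_smul]
    exact NormedSpace.exp_add_of_commute (((Commute.refl A).smul_left s).smul_right t)
  tendsto_zero x := by
    have h := (hasDerivAt_exp_smul_apply A x 0).continuousAt.tendsto
    simp only [zero_smul, NormedSpace.exp_zero, one_apply_eq_self] at h
    exact h.mono_left inf_le_left

theorem tendsto_exp_difference_quotient (A : X →L[ℝ] X) (x : X) :
    Tendsto (fun h : ℝ => h⁻¹ • (NormedSpace.exp (h • A) x - x)) (𝓝[>] 0) (𝓝 (A x)) := by
  have h := ((hasDerivAt_exp_smul_apply A x 0).hasDerivWithinAt (s := Ioi 0))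
  rw [hasDerivWithinAt_iff_tendsto_slope' (by simp)] at h
  simpa [slope_fun_def] using h

theorem isGenerator_exp (A : X →L[ℝ] X) :
    IsGenerator (fun t => NormedSpace.exp (t • A)) (A.toLinearMap.toPMap ⊤) := by
  intro x y
  have hx := tendsto_exp_difference_quotient A x
  rw [LinearPMap.mem_graph_iff]
  constructor
  · rintro ⟨z, rfl, rfl⟩
    exact hx
  · intro h
    exact ⟨⟨x, trivial⟩, rfl, tendsto_nhds_unique hx h⟩

end Banach

section Hilbert

variable {H : Type*} [NormedAddCommGroup H] [InnerProductSpace ℝ H] [CompleteSpace H]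

/-- A semigroup whose generator is dissipative up to `c` and densely defined grows at most like
`e^{c t}`. -/
theorem IsC0Semigroup.norm_le_exp {T : ℝ → H →L[ℝ] H} (hT : IsC0Semigroup T) {c : ℝ}
    (hg : ∀ x y : H, Tendsto (fun h : ℝ => h⁻¹ • (T h x - x)) (𝓝[>] 0) (𝓝 y) →
      inner ℝ y x ≤ c * ‖x‖ ^ 2)
    (hd : Dense {x : H | ∃ y, Tendsto (fun h : ℝ => h⁻¹ • (T h x - x)) (𝓝[>] 0) (𝓝 y)})
    {t : ℝ} (ht : 0 ≤ t) : ‖T t‖ ≤ Real.exp (c * t) := by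
  refine ContinuousLinearMap.opNorm_le_bound _ (Real.exp_nonneg _) fun x => ?_
  -- The inequality is closed in x, so it need only be checked on the dense domain, where orbits are
  -- right differentiable.
  refine hd.induction (P := fun x => ‖T t x‖ ≤ Real.exp (c * t) * ‖x‖) ?_
    (isClosed_le (by fun_prop) (by fun_prop)) x
  rintro x ⟨y, hy⟩
  have hder : ∀ s, 0 ≤ s → HasDerivWithinAt (fun s => ‖T s x‖ ^ 2)
      (2 * inner ℝ (T s x) (T s y)) (Ici s) s := fun s hs =>
    (hT.hasDerivWithinAt hy hs).2.norm_sq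
  -- Only a right derivative is at hand, hence the one-sided form of Grönwall. The squared norm
  -- grows at rate 2c; the square root is taken at the end.
  have := le_gronwallBound_of_liminf_deriv_right_le (f := fun s => ‖T s x‖ ^ 2)
    (f' := fun s => 2 * inner ℝ (T s x) (T s y)) (δ := ‖x‖ ^ 2) (K := 2 * c) (ε := 0) (a := 0)
    (b := t) (((hT.continuousOn x).mono Icc_subset_Ici_self).norm.pow 2)
    (fun s hs r hr => (hder s hs.1).liminf_right_slope_le hr) (by simp [hT.map_zero])
    (fun s hs => by
      have := hg _ _ (hT.hasDerivWithinAt hy hs.1).1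
      rw [real_inner_comm] at this
      linarith) t ⟨ht, le_rfl⟩
  rw [gronwallBound_ε0, sub_zero] at this
  refine (sq_le_sq₀ (norm_nonneg _) (by positivity)).1 ?_
  rw [mul_pow, ← Real.exp_nat_mul]
  refine this.trans_eq ?_
  rw [mul_comm]; congr 2; push_cast; ring

theorem norm_exp_smul_le {A : H →L[ℝ] H} {c : ℝ} (hA : ∀ x, inner ℝ (A x) x ≤ c * ‖x‖ ^ 2)
    {t : ℝ} (ht : 0 ≤ t) : ‖NormedSpace.exp (t • A)‖ ≤ Real.exp (c * t) := by
  refine (isC0Semigroup_exp A).norm_le_exp (fun x y h => ?_) ?_ ht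
  · rw [tendsto_nhds_unique h (tendsto_exp_difference_quotient A x)]; exact hA x
  · exact dense_univ.mono fun x _ => ⟨A x, tendsto_exp_difference_quotient A x⟩

end Hilbert

/-! ### Generation of contraction semigroups on Hilbert spaces -/

section Yosida

variable {H : Type*} [NormedAddCommGroup H] [InnerProductSpace ℝ H]

/-- The path s ↦ e^{(t-s)B} e^{sA} x joins e^{tB}x to e^{tA}x. Commutation makes its derivative
e^{(t-s)B} e^{sA}(A - B)x, and both exponentials are contractions. -/
theorem exp_smul_difference_bound [CompleteSpace H] {A B : H →L[ℝ] H} (hAB : Commute A B)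
    (hA : ∀ x, inner ℝ (A x) x ≤ 0) (hB : ∀ x, inner ℝ (B x) x ≤ 0) {t : ℝ} (ht : 0 ≤ t) (x : H) :
    ‖NormedSpace.exp (t • A) x - NormedSpace.exp (t • B) x‖ ≤ t * ‖A x - B x‖ := by
  have hc : ∀ s : ℝ, Commute B (NormedSpace.exp (s • A)) := fun s =>
    (hAB.symm.smul_right s).exp_right
  have cA : ∀ s : ℝ, 0 ≤ s → ‖NormedSpace.exp (s • A)‖ ≤ 1 := fun s hs => by
    simpa using norm_exp_smul_le (c := 0) (fun x => by simpa using hA x) hs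
  have cB : ∀ s : ℝ, 0 ≤ s → ‖NormedSpace.exp (s • B)‖ ≤ 1 := fun s hs => by
    simpa using norm_exp_smul_le (c := 0) (fun x => by simpa using hB x) hs
  have hd : ∀ s : ℝ, HasDerivAt
      (fun s : ℝ => NormedSpace.exp ((t - s) • B) (NormedSpace.exp (s • A) x))
      (NormedSpace.exp ((t - s) • B) (NormedSpace.exp (s • A) (A x - B x))) s := by
    intro s
    have h1 : HasDerivAt (fun s : ℝ => NormedSpace.exp ((t - s) • B))
        (-(NormedSpace.exp ((t - s) • B) * B)) s := by
      have := (hasDerivAt_exp_smul_const (𝕂 := ℝ) B (t - s)).scomp s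
        ((hasDerivAt_id s).const_sub t)
      simpa [Function.comp_def] using this
    have h2 := h1.clm_apply (hasDerivAt_exp_smul_apply A x s)
    refine h2.congr_deriv ?_
    have e : B (NormedSpace.exp (s • A) x) = NormedSpace.exp (s • A) (B x) :=
      congrArg (fun L : H →L[ℝ] H => L x) (hc s).eq
    simp [e, sub_eq_add_neg, add_comm]
  have := norm_image_sub_le_of_norm_deriv_right_le_segment (a := 0) (b := t)
    (C := ‖A x - B x‖)
    (fun s _ => (hd s).continuousAt.continuousWithinAt) (fun s _ => (hd s).hasDerivWithinAt)
    (fun s hs => by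
      refine ((NormedSpace.exp ((t - s) • B)).le_of_opNorm_le (cB _ (by linarith [hs.2])) _).trans ?_
      rw [one_mul]
      refine ((NormedSpace.exp (s • A)).le_of_opNorm_le (cA _ hs.1) _).trans ?_
      rw [one_mul]) t ⟨ht, le_rfl⟩
  simpa [mul_comm] using this

theorem norm_exp_smul_apply_sub_le [CompleteSpace H] {A : H →L[ℝ] H}
    (hA : ∀ x, inner ℝ (A x) x ≤ 0) {t : ℝ} (ht : 0 ≤ t) (x : H) :
    ‖NormedSpace.exp (t • A) x - x‖ ≤ t * ‖A x‖ := by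
  simpa using exp_smul_difference_bound (Commute.zero_right A) hA (by simp) ht x

/-- The auxiliary vector y approximates `A x`, so the remainder involves ‖A y‖ instead of ‖A² x‖.
For Yosida approximations and y in the domain this stays bounded, and the estimate survives the
limit. -/
theorem norm_exp_smul_apply_sub_sub_le [CompleteSpace H] {A : H →L[ℝ] H}
    (hA : ∀ x, inner ℝ (A x) x ≤ 0) {t : ℝ} (ht : 0 ≤ t) (x y : H) :
    ‖NormedSpace.exp (t • A) x - x - t • A x‖ ≤ t * (2 * ‖A x - y‖ + t * ‖A y‖) := by
  have cA : ∀ s : ℝ, 0 ≤ s → ‖NormedSpace.exp (s • A)‖ ≤ 1 := fun s hs => by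
    simpa using norm_exp_smul_le (c := 0) (fun x => by simpa using hA x) hs
  have hd : ∀ s : ℝ, HasDerivAt (fun s : ℝ => NormedSpace.exp (s • A) x - s • A x)
      (NormedSpace.exp (s • A) (A x) - A x) s := fun s => by
    simpa using! (hasDerivAt_exp_smul_apply A x s).sub ((hasDerivAt_id s).smul_const (A x))
  have := norm_image_sub_le_of_norm_deriv_right_le_segment (a := 0) (b := t)
    (C := 2 * ‖A x - y‖ + t * ‖A y‖)
    (fun s _ => (hd s).continuousAt.continuousWithinAt) (fun s _ => (hd s).hasDerivWithinAt)
    (fun s hs => by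
      have e : NormedSpace.exp (s • A) (A x) - A x = NormedSpace.exp (s • A) (A x - y) +
          (NormedSpace.exp (s • A) y - y) - (A x - y) := by rw [map_sub]; abel
      have h1 := (NormedSpace.exp (s • A)).le_of_opNorm_le (cA s hs.1) (A x - y)
      have h2 := norm_exp_smul_apply_sub_le hA hs.1 y
      have h3 : s * ‖A y‖ ≤ t * ‖A y‖ := by gcongr; exact hs.2.le
      rw [e]
      refine (norm_sub_le _ _).trans ?_
      have := norm_add_le (NormedSpace.exp (s • A) (A x - y)) (NormedSpace.exp (s • A) y - y)
      linarith) t ⟨ht, le_rfl⟩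
  simp only [zero_smul, NormedSpace.exp_zero, one_apply_eq_self, sub_zero] at this
  rw [sub_right_comm, mul_comm]
  exact this

/-! ### Resolvents, Yosida approximations and the Lumer–Phillips theorem -/

variable {P : Submodule ℝ (H × H)}

theorem eq_zero_of_dissipative (hP : ∀ x y, (x, y) ∈ P → inner ℝ y x ≤ 0) {l : ℝ} (hl : 0 < l)
    {x : H} (hx : (x, l • x) ∈ P) : x = 0 := by
  have := hP _ _ hx
  rw [real_inner_smul_left, real_inner_self_eq_norm_sq] at this
  have h2 : ‖x‖ ^ 2 ≤ 0 := by
    by_contra! h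
    exact absurd this (not_le.2 (mul_pos hl h))
  simpa using h2

/-- The resolvent of a dissipative relation with full range. -/
theorem exists_resolvent (hP : ∀ x y, (x, y) ∈ P → inner ℝ y x ≤ 0) {l : ℝ} (hl : 0 < l)
    (hr : ∀ z, ∃ x, (x, l • x - z) ∈ P) :
    ∃ R : H →L[ℝ] H, (∀ z, (R z, l • R z - z) ∈ P) ∧ (∀ x y, (x, y) ∈ P → R (l • x - y) = x) ∧
      ∀ z, ‖R z‖ ≤ l⁻¹ * ‖z‖ := by
  choose R hR using hr
  -- Two solutions differ by an eigenvector for l > 0, which dissipativity excludes. This uniqueness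
  -- is what makes the chosen `R` linear.
  have uniq : ∀ x z, (x, l • x - z) ∈ P → x = R z := fun x z h => by
    rw [← sub_eq_zero]
    refine eq_zero_of_dissipative hP hl ?_
    convert P.sub_mem h (hR z) using 1
    simp [smul_sub]
  have hb : ∀ z, ‖R z‖ ≤ l⁻¹ * ‖z‖ := fun z => by
    have h := hP _ _ (hR z)
    rw [inner_sub_left, real_inner_smul_left, real_inner_self_eq_norm_sq] at h
    have h2 := real_inner_le_norm z (R z)
    rw [le_inv_mul_iff₀ hl]
    rcases (norm_nonneg (R z)).eq_or_lt with h0 | h0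
    · rw [← h0]; simp
    · refine le_of_mul_le_mul_right ?_ h0
      nlinarith
  let R' : H →ₗ[ℝ] H :=
    { toFun := R
      map_add' := fun z w => (uniq _ _ (by
        convert P.add_mem (hR z) (hR w) using 1
        simp only [Prod.mk_add_mk, smul_add, Prod.mk.injEq, true_and]; abel)).symm
      map_smul' := fun c z => (uniq _ _ (by
        convert P.smul_mem c (hR z) using 1
        simp only [Prod.smul_mk, smul_sub, RingHom.id_apply, smul_comm c l])).symm }
  refine ⟨R'.mkContinuous l⁻¹ hb, hR, fun x y h => (uniq _ _ ?_).symm, hb⟩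
  simpa using h

/-- Let z be orthogonal to the domain and solve (x, lx - z) ∈ P. Orthogonality removes ⟨z, x⟩ from
the dissipativity estimate, so l‖x‖² ≤ c‖x‖² and x = 0. Then (0, -z) ∈ P, and single-valuedness
gives z = 0. -/
theorem dense_domain_of_dissipative [CompleteSpace H] {c : ℝ}
    (hP : ∀ x y, (x, y) ∈ P → inner ℝ y x ≤ c * ‖x‖ ^ 2) (hs : ∀ y, (0, y) ∈ P → y = 0) {l : ℝ} (hl : c < l)
    (hr : ∀ z, ∃ x, (x, l • x - z) ∈ P) : Dense {x | ∃ y, (x, y) ∈ P} := by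
  have e : {x | ∃ y, (x, y) ∈ P} = (P.map (LinearMap.fst ℝ H H) : Set H) := by
    ext x; simp
  rw [e, Submodule.dense_iff_topologicalClosure_eq_top, Submodule.topologicalClosure_eq_top_iff,
    Submodule.eq_bot_iff]
  intro z hz
  obtain ⟨x, hx⟩ := hr z
  have h1 : inner ℝ x z = 0 := hz x ⟨_, hx, rfl⟩
  have h2 := hP _ _ hx
  rw [inner_sub_left, real_inner_smul_left, real_inner_self_eq_norm_sq, real_inner_comm, h1,
    sub_zero] at h2
  have h3 : x = 0 := by
    have : ‖x‖ ^ 2 ≤ 0 := by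
      by_contra! h
      exact absurd (le_of_mul_le_mul_right h2 h) (not_le.2 hl)
    simpa using this
  subst h3
  simpa using hs _ hx

/-- The Yosida approximations of a dissipative relation with full range. -/
theorem exists_yosida_approximation [CompleteSpace H]
    (hP : ∀ x y, (x, y) ∈ P → inner ℝ y x ≤ 0) (hs : ∀ y, (0, y) ∈ P → y = 0)
    (hr : ∀ l : ℝ, 0 < l → ∀ z, ∃ x, (x, l • x - z) ∈ P) :
    ∃ A : ℕ → H →L[ℝ] H, (∀ n x, inner ℝ (A n x) x ≤ 0) ∧ (∀ m n, Commute (A m) (A n)) ∧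
      (∀ n x y, (x, y) ∈ P → ‖A n x‖ ≤ ‖y‖) ∧
      ∀ x y, (x, y) ∈ P → Tendsto (fun n => A n x) atTop (𝓝 y) := by
  let l : ℕ → ℝ := fun n => n + 1
  have hl : ∀ n, 0 < l n := fun n => by positivity
  choose R hR hinv hb using fun n => exists_resolvent hP (hl n) (hr _ (hl n))
  have hlR : ∀ n z, ‖l n • R n z‖ ≤ ‖z‖ := fun n z => by
    rw [norm_smul, Real.norm_of_nonneg (hl n).le, ← le_inv_mul_iff₀ (hl n)]; exact hb n z
  have happ : ∀ n x y, (x, y) ∈ P → l n • (l n • R n x - x) = l n • R n y := fun n x y h => by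
    have := hinv n x y h
    rw [map_sub, map_smul] at this
    rw [sub_eq_iff_eq_add, ← sub_eq_iff_eq_add'] at this
    rw [this]
  -- The resolvent identity; its antisymmetry in m and n yields commutation of the resolvents.
  have hres : ∀ m n z, (l m - l n) • R m (R n z) = R n z - R m z := fun m n z => by
    have := hinv m _ _ (hR n z)
    simp only [map_sub, map_smul] at this
    rw [sub_smul, eq_sub_iff_add_eq]
    refine Eq.trans ?_ this
    abel
  have hcomm : ∀ m n, Commute (R m) (R n) := fun m n => by
    refine ContinuousLinearMap.ext fun z => ?_
    change R m (R n z) = R n (R m z)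
    rcases eq_or_ne m n with rfl | h
    · rfl
    · have hne : l m - l n ≠ 0 := by simpa [l, sub_eq_zero] using h
      refine smul_right_injective H hne ?_
      change (l m - l n) • R m (R n z) = (l m - l n) • R n (R m z)
      rw [hres, ← neg_sub (l n), neg_smul, hres, neg_sub]
  -- This is l_n times the relation evaluated at `R n`, and it takes x to l_n R_n y whenever (x, y)
  -- ∈ P.
  refine ⟨fun n => l n • (l n • R n - 1), fun n x => ?_, fun m n => ?_, fun n x y h => ?_,
    fun x y h => ?_⟩
  · have h1 := (real_inner_le_norm (l n • R n x) x).trans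
      (mul_le_mul_of_nonneg_right (hlR n x) (norm_nonneg x))
    have h2 : inner ℝ ((l n • (l n • R n - 1)) x) x =
        l n * (inner ℝ (l n • R n x) x - ‖x‖ ^ 2) := by
      simp [real_inner_smul_left, inner_sub_left]
    rw [h2]
    exact mul_nonpos_of_nonneg_of_nonpos (hl n).le (by nlinarith)
  · have h1 : Commute (l m • R m - 1) (l n • R n - 1) :=
      ((((hcomm m n).smul_left _).smul_right _).sub_left (Commute.one_left _)).sub_right
        (Commute.one_right _)
    exact (h1.smul_left _).smul_right _
  · have := happ n x y h
    simp only [FunLike.coe_smul, FunLike.coe_sub, Pi.smul_apply, Pi.sub_apply, one_apply_eq_self]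
    rw [this]; exact hlR n y
  · have h1 : ∀ n, (l n • (l n • R n - 1)) x = l n • R n y := fun n => by
      simpa using happ n x y h
    simp only [h1]
    rw [Metric.tendsto_atTop]
    intro ε hε
    -- It remains to see that l_n R_n → 1 strongly. For y' in the domain with image v, l_n R_n y' -
    -- y' = R_n v = O(1/l_n); density and ‖l_n R_n‖ ≤ 1 do the rest.
    obtain ⟨y', ⟨v, hv⟩, hy'⟩ :=
      (dense_domain_of_dissipative (c := 0) (by simpa using hP) hs zero_lt_one (hr 1 zero_lt_one)).exists_dist_lt y
        (ε := ε / 3) (by positivity)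
    have h2 : Tendsto (fun n => (l n)⁻¹ * ‖v‖) atTop (𝓝 0) := by
      simpa [l] using (tendsto_one_div_add_atTop_nhds_zero_nat (𝕜 := ℝ)).mul_const ‖v‖
    obtain ⟨N, hN⟩ := (h2.eventually_lt_const (show 0 < ε / 3 by positivity)).exists_forall_of_atTop
    refine ⟨N, fun n hn => ?_⟩
    have h3 : l n • R n y - y = l n • R n (y - y') + R n v - (y - y') := by
      have := hinv n _ _ hv
      rw [map_sub, map_smul] at this
      rw [map_sub, smul_sub, sub_eq_iff_eq_add.1 this]; abel
    rw [dist_eq_norm, h3]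
    rw [dist_eq_norm] at hy'
    have h4 := hlR n (y - y')
    have h5 := (hb n v).trans_lt (hN n hn)
    have h6 := norm_sub_le (l n • R n (y - y') + R n v) (y - y')
    have h7 := norm_add_le (l n • R n (y - y')) (R n v)
    linarith

/-- A single-valued dissipative relation on a Hilbert space such that `l - P` is onto for all `l > 0`
is the graph of the generator of a strongly continuous semigroup. -/
theorem exists_semigroup_of_dissipative [CompleteSpace H]
    (hP : ∀ x y, (x, y) ∈ P → inner ℝ y x ≤ 0) (hs : ∀ y, (0, y) ∈ P → y = 0)
    (hr : ∀ l : ℝ, 0 < l → ∀ z, ∃ x, (x, l • x - z) ∈ P) :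
    ∃ T : ℝ → H →L[ℝ] H, IsC0Semigroup T ∧
      ∀ x y, (x, y) ∈ P ↔ Tendsto (fun h : ℝ => h⁻¹ • (T h x - x)) (𝓝[>] 0) (𝓝 y) := by
  have hdense := dense_domain_of_dissipative (c := 0) (by simpa using hP) hs zero_lt_one (hr 1 zero_lt_one)
  obtain ⟨A, hA, hcomm, hAle, hlim⟩ := exists_yosida_approximation hP hs hr
  have hc : ∀ n (s : ℝ), 0 ≤ s → ∀ x, ‖NormedSpace.exp (s • A n) x‖ ≤ ‖x‖ := fun n s hs x => by
    have : ‖NormedSpace.exp (s • A n)‖ ≤ 1 := by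
      simpa using norm_exp_smul_le (c := 0) (fun x => by simpa using hA n x) hs
    simpa using ContinuousLinearMap.le_of_opNorm_le _ this x
  have hT : ∀ t : ℝ, 0 ≤ t → ∃ L : H →L[ℝ] H,
      ∀ x, Tendsto (fun n => NormedSpace.exp (t • A n) x) atTop (𝓝 (L x)) := by
    intro t ht
    have hcau : ∀ x, CauchySeq fun n => NormedSpace.exp (t • A n) x := by
      intro x
      rw [Metric.cauchySeq_iff]
      intro ε hε
      -- On the domain the exponentials are Cauchy because the A_n x' are; contractivity carries
      -- this over to every x.
      obtain ⟨x', ⟨y, hy⟩, hx'⟩ := hdense.exists_dist_lt x (ε := ε / 4) (by positivity)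
      obtain ⟨N, hN⟩ := Metric.cauchySeq_iff.1 (hlim x' y hy).cauchySeq (ε / (4 * (t + 1)))
        (by positivity)
      refine ⟨N, fun m hm n hn => ?_⟩
      have h1 := hN m hm n hn
      rw [dist_eq_norm] at h1 hx' ⊢
      have h2 := exp_smul_difference_bound (hcomm m n) (hA m) (hA n) ht x'
      have h3 : t * ‖A m x' - A n x'‖ ≤ ε / 4 := by
        calc t * ‖A m x' - A n x'‖ ≤ (t + 1) * (ε / (4 * (t + 1))) := by gcongr; linarith
          _ = ε / 4 := by field_simp
      have e : NormedSpace.exp (t • A m) x - NormedSpace.exp (t • A n) x =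
          NormedSpace.exp (t • A m) (x - x') - NormedSpace.exp (t • A n) (x - x') +
          (NormedSpace.exp (t • A m) x' - NormedSpace.exp (t • A n) x') := by
        simp only [map_sub]; abel
      rw [e]
      have h4 := hc m t ht (x - x')
      have h5 := hc n t ht (x - x')
      have h6 := norm_add_le (NormedSpace.exp (t • A m) (x - x') -
        NormedSpace.exp (t • A n) (x - x'))
        (NormedSpace.exp (t • A m) x' - NormedSpace.exp (t • A n) x')
      have h7 := norm_sub_le (NormedSpace.exp (t • A m) (x - x'))
        (NormedSpace.exp (t • A n) (x - x'))
      linarith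
    choose L hL using fun x => cauchySeq_tendsto_of_complete (hcau x)
    exact ⟨continuousLinearMapOfTendsto (fun n => NormedSpace.exp (t • A n)) (tendsto_pi_nhds.2 hL),
      hL⟩
  -- The values of `T` at negative times are arbitrary.
  choose! T hT using hT
  have hTc : ∀ t : ℝ, 0 ≤ t → ∀ x, ‖T t x‖ ≤ ‖x‖ := fun t ht x =>
    le_of_tendsto (hT t ht x).norm (Eventually.of_forall fun n => hc n t ht x)
  have hsub : ∀ t : ℝ, 0 ≤ t → ∀ x y, (x, y) ∈ P → ‖T t x - x‖ ≤ t * ‖y‖ := fun t ht x y h =>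
    le_of_tendsto_of_tendsto ((hT t ht x).sub_const x).norm ((hlim x y h).norm.const_mul t)
      (Eventually.of_forall fun n => norm_exp_smul_apply_sub_le (hA n) ht x)
  have hsub2 : ∀ t : ℝ, 0 ≤ t → ∀ x y x' y', (x, y) ∈ P → (x', y') ∈ P →
      ‖T t x - x - t • y‖ ≤ t * (2 * ‖y - x'‖ + t * ‖y'‖) := fun t ht x y x' y' h h' => by
    refine le_of_tendsto_of_tendsto (((hT t ht x).sub_const x).sub ((hlim x y h).const_smul t)).norm
      (((((hlim x y h).sub_const x').norm.const_mul 2).add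
        ((hlim x' y' h').norm.const_mul t)).const_mul t)
      (Eventually.of_forall fun n => norm_exp_smul_apply_sub_sub_le (hA n) ht x x')
  have hgen : ∀ x y, (x, y) ∈ P →
      Tendsto (fun h : ℝ => h⁻¹ • (T h x - x)) (𝓝[>] 0) (𝓝 y) := by
    intro x y hxy
    rw [Metric.tendsto_nhdsWithin_nhds]
    intro ε hε
    obtain ⟨x', ⟨y', hy'⟩, hx'⟩ := hdense.exists_dist_lt y (ε := ε / 4) (by positivity)
    refine ⟨ε / (4 * (‖y'‖ + 1)), by positivity, fun {h} hh hd => ?_⟩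
    have hh : 0 < h := hh
    rw [dist_zero_right, Real.norm_of_nonneg hh.le] at hd
    have h1 := hsub2 h hh.le x y x' y' hxy hy'
    have h2 : h⁻¹ • (T h x - x) - y = h⁻¹ • (T h x - x - h • y) := by
      rw [smul_sub _ _ (h • y), inv_smul_smul₀ hh.ne']
    have h3 : h * ‖y'‖ ≤ ε / 4 := by
      calc h * ‖y'‖ ≤ (ε / (4 * (‖y'‖ + 1))) * (‖y'‖ + 1) := by gcongr; linarith
        _ = ε / 4 := by field_simp
    rw [dist_eq_norm, h2, norm_smul, norm_inv, Real.norm_of_nonneg hh.le]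
    rw [dist_eq_norm] at hx'
    have h4 : h⁻¹ * ‖T h x - x - h • y‖ ≤ 2 * ‖y - x'‖ + h * ‖y'‖ := by
      rwa [inv_mul_le_iff₀ hh]
    linarith
  have hC0 : IsC0Semigroup T := by
    refine ⟨?_, fun s t hs ht => ?_, fun x => ?_⟩
    · ext x
      refine tendsto_nhds_unique (hT 0 le_rfl x) ?_
      simp
    · ext x
      refine tendsto_nhds_unique (hT (s + t) (by positivity) x) ?_
      have e : ∀ n, NormedSpace.exp ((s + t) • A n) x =
          NormedSpace.exp (s • A n) (NormedSpace.exp (t • A n) x - T t x) +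
            NormedSpace.exp (s • A n) (T t x) := fun n => by
        rw [map_sub, sub_add_cancel]
        exact congrArg (fun L : H →L[ℝ] H => L x) ((isC0Semigroup_exp (A n)).map_add s t hs ht)
      simp only [e]
      have h1 : Tendsto (fun n => NormedSpace.exp (s • A n) (NormedSpace.exp (t • A n) x - T t x))
          atTop (𝓝 0) := by
        rw [tendsto_zero_iff_norm_tendsto_zero]
        refine squeeze_zero (fun n => norm_nonneg _) (fun n => hc n s hs _) ?_
        exact tendsto_iff_norm_sub_tendsto_zero.1 (hT t ht x)
      simpa using h1.add (hT s hs (T t x))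
    · rw [Metric.tendsto_nhdsWithin_nhds]
      intro ε hε
      obtain ⟨x', ⟨y', hy'⟩, hx'⟩ := hdense.exists_dist_lt x (ε := ε / 3) (by positivity)
      refine ⟨ε / (3 * (‖y'‖ + 1)), by positivity, fun {h} hh hd => ?_⟩
      have hh : 0 < h := hh
      rw [dist_zero_right, Real.norm_of_nonneg hh.le] at hd
      rw [dist_eq_norm] at hx' ⊢
      have h1 := hsub h hh.le x' y' hy'
      have h3 : h * ‖y'‖ ≤ ε / 3 := by
        calc h * ‖y'‖ ≤ (ε / (3 * (‖y'‖ + 1))) * (‖y'‖ + 1) := by gcongr; linarith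
          _ = ε / 3 := by field_simp
      have e : T h x - x = T h (x - x') + (T h x' - x') - (x - x') := by
        rw [map_sub]; abel
      have h4 := hTc h hh.le (x - x')
      have h5 := norm_sub_le (T h (x - x') + (T h x' - x')) (x - x')
      have h6 := norm_add_le (T h (x - x')) (T h x' - x')
      rw [e]; linarith
  refine ⟨T, hC0, fun x y => ⟨hgen x y, fun h => ?_⟩⟩
  -- Maximality: the generator of `T` already extends P. If it sends x to y, choose z with (z, z -
  -- (x - y)) ∈ P; then it fixes w = x - z. Contractivity makes the difference quotients at w have
  -- nonpositive inner product with w, so ‖w‖² ≤ 0.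
  obtain ⟨z, hz⟩ := hr 1 zero_lt_one (x - y)
  rw [one_smul] at hz
  have hw : Tendsto (fun h : ℝ => h⁻¹ • (T h (x - z) - (x - z))) (𝓝[>] 0) (𝓝 (x - z)) := by
    have := h.sub (hgen _ _ hz)
    rw [show y - (z - (x - y)) = x - z by abel] at this
    refine this.congr fun h => ?_
    rw [← smul_sub, map_sub]; congr 1; abel
  have hxz : ‖x - z‖ ^ 2 ≤ 0 := by
    rw [← real_inner_self_eq_norm_sq]
    refine le_of_tendsto (hw.inner tendsto_const_nhds) ?_
    filter_upwards [self_mem_nhdsWithin] with h hh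
    have hh : 0 < h := hh
    rw [real_inner_smul_left, inner_sub_left, real_inner_self_eq_norm_sq]
    refine mul_nonpos_of_nonneg_of_nonpos (inv_nonneg.2 hh.le) ?_
    have h1 := (real_inner_le_norm (T h (x - z)) (x - z)).trans
      (mul_le_mul_of_nonneg_right (hTc h hh.le (x - z)) (norm_nonneg _))
    nlinarith
  have hxz : x = z := by simpa [sub_eq_zero] using hxz
  subst hxz
  simpa using hz

theorem tendsto_quotient_exp_smul {S : ℝ → H →L[ℝ] H} (c : ℝ) {x y : H}
    (h : Tendsto (fun h : ℝ => h⁻¹ • (S h x - x)) (𝓝[>] 0) (𝓝 y)) :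
    Tendsto (fun h : ℝ => h⁻¹ • ((Real.exp (c * h) • S h) x - x)) (𝓝[>] 0) (𝓝 (y + c • x)) := by
  have h1 : Tendsto (fun t => Real.exp (c * t)) (𝓝[>] 0) (𝓝 1) := by
    have : Continuous fun t => Real.exp (c * t) := by fun_prop
    exact (this.tendsto' 0 1 (by simp)).mono_left inf_le_left
  have h2 : HasDerivAt (fun t => Real.exp (c * t)) c 0 := by
    simpa using ((hasDerivAt_id (0 : ℝ)).const_mul c).exp
  have h3 := h2.hasDerivWithinAt (s := Ioi 0)
  rw [hasDerivWithinAt_iff_tendsto_slope' (by simp)] at h3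
  have h4 := (h1.smul h).add (h3.smul_const x)
  rw [one_smul] at h4
  refine h4.congr fun t => ?_
  simp only [slope_def_module, sub_zero, mul_zero, Real.exp_zero, FunLike.coe_smul, Pi.smul_apply,
    smul_assoc]
  rw [smul_comm, ← smul_add]
  congr 1
  rw [smul_sub, sub_smul, one_smul]; abel

/-- The shifted version: `P - c` is dissipative and `l - P` is onto for all `l > c`. -/
theorem exists_semigroup_of_quasidissipative [CompleteSpace H] {c : ℝ}
    (hP : ∀ x y, (x, y) ∈ P → inner ℝ y x ≤ c * ‖x‖ ^ 2) (hs : ∀ y, (0, y) ∈ P → y = 0)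
    (hr : ∀ l : ℝ, c < l → ∀ z, ∃ x, (x, l • x - z) ∈ P) :
    ∃ T : ℝ → H →L[ℝ] H, IsC0Semigroup T ∧
      ∀ x y, (x, y) ∈ P ↔ Tendsto (fun h : ℝ => h⁻¹ • (T h x - x)) (𝓝[>] 0) (𝓝 y) := by
  -- Pulling back along this shear replaces P by P - c, which is dissipative. The factor e^{ct} on
  -- the resulting semigroup undoes the shift.
  let f : H × H →ₗ[ℝ] H × H :=
    (LinearMap.fst ℝ H H).prod (LinearMap.snd ℝ H H + c • LinearMap.fst ℝ H H)
  have hf : ∀ x y, (x, y) ∈ P.comap f ↔ (x, y + c • x) ∈ P := fun x y => Iff.rfl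
  obtain ⟨S, hS, hSg⟩ := exists_semigroup_of_dissipative (P := P.comap f)
    (fun x y h => by
      have := hP _ _ ((hf x y).1 h)
      rw [inner_add_left, real_inner_smul_left, real_inner_self_eq_norm_sq] at this
      linarith)
    (fun y h => hs y (by simpa using (hf 0 y).1 h))
    (fun l hl z => by
      obtain ⟨x, hx⟩ := hr (l + c) (by linarith) z
      refine ⟨x, (hf _ _).2 ?_⟩
      convert hx using 2
      rw [add_smul]; abel)
  refine ⟨fun t => Real.exp (c * t) • S t, ⟨?_, fun s t hs ht => ?_, fun x => ?_⟩, fun x y => ?_⟩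
  · simp [hS.map_zero]
  · ext x
    simp [hS.map_add s t hs ht, mul_add, Real.exp_add, smul_smul, mul_comm]
  · have h1 : Tendsto (fun t => Real.exp (c * t)) (𝓝[>] 0) (𝓝 1) := by
      have : Continuous fun t => Real.exp (c * t) := by fun_prop
      exact (this.tendsto' 0 1 (by simp)).mono_left inf_le_left
    simpa using h1.smul (hS.tendsto_zero x)
  · have h := hf x (y - c • x)
    rw [sub_add_cancel] at h
    rw [← h, hSg]
    constructor
    · intro h1
      simpa using tendsto_quotient_exp_smul c h1
    · intro h1
      simpa [smul_smul, ← Real.exp_add, sub_eq_add_neg] using tendsto_quotient_exp_smul (-c) h1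

end Yosida

/-! ### Primitives and weak derivatives on the history interval -/

section Primitives

variable {τ : ℝ} {d : ℕ}

theorem integral_hist {E : Type*} [NormedAddCommGroup E] [NormedSpace ℝ E] (hτ : 0 < τ)
    (f : ℝ → E) : ∫ θ, f θ ∂(hist τ) = ∫ θ in (-τ)..0, f θ := by
  rw [hist, integral_Ico_eq_integral_Ioc, intervalIntegral.integral_of_le (by linarith)]

theorem integrable_hist_iff {E : Type*} [NormedAddCommGroup E] (hτ : 0 < τ)
    {f : ℝ → E} : Integrable f (hist τ) ↔ IntervalIntegrable f volume (-τ) 0 := by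
  rw [intervalIntegrable_iff_integrableOn_Ico_of_le (by linarith)]; rfl

theorem integral_wHist {E : Type*} [NormedAddCommGroup E] [NormedSpace ℝ E] (hτ : 0 < τ)
    (f : ℝ → E) : ∫ θ, f θ ∂(wHist τ) = τ⁻¹ • ∫ θ, f θ ∂(hist τ) := by
  rw [wHist, integral_smul_measure, ENNReal.toReal_ofReal (by positivity)]

/-- Integration by parts for absolutely continuous functions, the derivative of the primitive being
`g` almost everywhere by Lebesgue differentiation. -/
theorem integral_deriv_mul_primitive {F g : ℝ → ℝ} {p q c : ℝ} (α : ℝ)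
    (hF : AbsolutelyContinuousOnInterval F p q) (hg : IntervalIntegrable g volume p q)
    (hc : c ∈ uIcc p q) :
    ∫ x in p..q, (deriv F x * (α + ∫ s in c..x, g s) + F x * g x) =
      F q * (α + ∫ s in c..q, g s) - F p * (α + ∫ s in c..p, g s) := by
  have hG : AbsolutelyContinuousOnInterval (fun x => α + ∫ s in c..x, g s) p q :=
    (contDiffOn_const.absolutelyContinuousOnInterval).fun_add
      (hg.absolutelyContinuousOnInterval_intervalIntegral hc)
  rw [← hF.integral_deriv_mul_eq_sub hG]
  refine intervalIntegral.integral_congr_ae ?_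
  filter_upwards [hg.ae_hasDerivAt_integral] with x hx hm
  rw [((hx (uIoc_subset_uIcc hm) c hc).const_add α).deriv]

theorem primitive_apply {g : ℝ → Vec d} {p q c x : ℝ} (γ : Vec d)
    (hg : IntervalIntegrable g volume p q) (hc : c ∈ uIcc p q) (hx : x ∈ uIcc p q) (i : Fin d) :
    (γ + ∫ s in c..x, g s) i = γ i + ∫ s in c..x, g s i := by
  have h := (EuclideanSpace.proj (𝕜 := ℝ) i).intervalIntegral_comp_comm
    (hg.mono_set (uIcc_subset_uIcc hc hx))
  simp only [PiLp.proj_apply] at h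
  rw [PiLp.add_apply, h]

theorem intervalIntegrable_apply {g : ℝ → Vec d} {p q : ℝ}
    (hg : IntervalIntegrable g volume p q) (i : Fin d) :
    IntervalIntegrable (fun s => g s i) volume p q :=
  ⟨(EuclideanSpace.proj (𝕜 := ℝ) i).integrable_comp hg.1,
    (EuclideanSpace.proj (𝕜 := ℝ) i).integrable_comp hg.2⟩

theorem continuousOn_primitive {g : ℝ → Vec d} {p q c : ℝ} (γ : Vec d)
    (hg : IntervalIntegrable g volume p q) (hc : c ∈ uIcc p q) :
    ContinuousOn (fun x => γ + ∫ s in c..x, g s) (uIcc p q) :=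
  continuousOn_const.add (intervalIntegral.continuousOn_primitive_interval' hg hc)

/-- Integration by parts for a smooth scalar function and a vector-valued primitive. -/
theorem integral_deriv_smul_primitive {F : ℝ → ℝ} (hF : ContDiff ℝ 1 F) {g : ℝ → Vec d}
    {p q c : ℝ} (γ : Vec d) (hg : IntervalIntegrable g volume p q) (hc : c ∈ uIcc p q) :
    ∫ x in p..q, (deriv F x • (γ + ∫ s in c..x, g s) + F x • g x) =
      F q • (γ + ∫ s in c..q, g s) - F p • (γ + ∫ s in c..p, g s) := by
  have hi : IntervalIntegrable (fun x => deriv F x • (γ + ∫ s in c..x, g s) + F x • g x)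
      volume p q :=
    (((hF.continuous_deriv le_rfl).continuousOn.smul
      (continuousOn_primitive γ hg hc)).intervalIntegrable).add
      (hg.continuousOn_smul hF.continuous.continuousOn)
  ext i
  have h := (EuclideanSpace.proj (𝕜 := ℝ) i).intervalIntegral_comp_comm hi
  simp only [PiLp.proj_apply] at h
  rw [← h, PiLp.sub_apply, PiLp.smul_apply, PiLp.smul_apply,
    primitive_apply γ hg hc right_mem_uIcc, primitive_apply γ hg hc left_mem_uIcc, smul_eq_mul,
    smul_eq_mul, ← integral_deriv_mul_primitive (γ i)
      (hF.contDiffOn.absolutelyContinuousOnInterval) (intervalIntegrable_apply hg i) hc]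
  refine intervalIntegral.integral_congr fun x hx => ?_
  change (deriv F x • (γ + ∫ s in c..x, g s)) i + (F x • g x) i = _
  rw [PiLp.smul_apply, PiLp.smul_apply, primitive_apply γ hg hc hx]
  rfl

/-- The energy identity for a primitive. -/
theorem integral_inner_primitive {g : ℝ → Vec d} {p q c : ℝ} (γ : Vec d)
    (hg : IntervalIntegrable g volume p q) (hc : c ∈ uIcc p q) :
    ∫ x in p..q, inner ℝ (g x) (γ + ∫ s in c..x, g s) =
      (‖γ + ∫ s in c..q, g s‖ ^ 2 - ‖γ + ∫ s in c..p, g s‖ ^ 2) / 2 := by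
  have hcont : ∀ i, ContinuousOn (fun x => γ i + ∫ s in c..x, g s i) (uIcc p q) := fun i =>
    continuousOn_const.add
      (intervalIntegral.continuousOn_primitive_interval' (intervalIntegrable_apply hg i) hc)
  have hi : ∀ i, IntervalIntegrable (fun x => g x i * (γ i + ∫ s in c..x, g s i)) volume p q :=
    fun i => (intervalIntegrable_apply hg i).mul_continuousOn (hcont i)
  have h1 : ∫ x in p..q, inner ℝ (g x) (γ + ∫ s in c..x, g s) =
      ∫ x in p..q, ∑ i, g x i * (γ i + ∫ s in c..x, g s i) := by
    refine intervalIntegral.integral_congr fun x hx => ?_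
    simp only [PiLp.inner_apply, primitive_apply γ hg hc hx]
    simp [mul_comm]
  rw [h1, intervalIntegral.integral_finsetSum fun i _ => hi i, EuclideanSpace.real_norm_sq_eq,
    EuclideanSpace.real_norm_sq_eq, ← Finset.sum_sub_distrib, Finset.sum_div]
  refine Finset.sum_congr rfl fun i _ => ?_
  rw [primitive_apply γ hg hc right_mem_uIcc, primitive_apply γ hg hc left_mem_uIcc]
  have hac : AbsolutelyContinuousOnInterval (fun x => γ i + ∫ s in c..x, g s i) p q :=
    (contDiffOn_const.absolutelyContinuousOnInterval).fun_add
      ((intervalIntegrable_apply hg i).absolutelyContinuousOnInterval_intervalIntegral hc)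
  -- The primitive is integrated by parts against itself, which doubles the integrand and accounts
  -- for the factor 1/2.
  have h2 := integral_deriv_mul_primitive (γ i) hac (intervalIntegrable_apply hg i) hc
  have h3 : ∫ x in p..q, (deriv (fun x => γ i + ∫ s in c..x, g s i) x *
        (γ i + ∫ s in c..x, g s i) + (γ i + ∫ s in c..x, g s i) * g x i) =
      ∫ x in p..q, 2 * (g x i * (γ i + ∫ s in c..x, g s i)) := by
    refine intervalIntegral.integral_congr_ae ?_
    filter_upwards [(intervalIntegrable_apply hg i).ae_hasDerivAt_integral] with x hx hm
    rw [((hx (uIoc_subset_uIcc hm) c hc).const_add (γ i)).deriv]; ring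
  rw [h3, intervalIntegral.integral_const_mul] at h2
  linarith

/-- A primitive satisfies the defining identity of the weak derivative. -/
theorem integral_deriv_smul_primitive_of_tsupport (hτ : 0 < τ) {g : ℝ → Vec d} (γ : Vec d)
    (hg : IntervalIntegrable g volume (-τ) 0) {φ : ℝ → ℝ} (hφ : ContDiff ℝ ∞ φ)
    (hs : tsupport φ ⊆ Ioo (-τ) 0) :
    ∫ θ, deriv φ θ • (γ + ∫ s in 0..θ, g s) ∂(hist τ) = -∫ θ, φ θ • g θ ∂(hist τ) := by
  have z1 : φ 0 = 0 := image_eq_zero_of_notMem_tsupport fun h => lt_irrefl _ (hs h).2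
  have z2 : φ (-τ) = 0 := image_eq_zero_of_notMem_tsupport fun h => lt_irrefl _ (hs h).1
  have h := integral_deriv_smul_primitive (hφ.of_le (by simp)) γ hg right_mem_uIcc
  rw [intervalIntegral.integral_add (f := fun x => deriv φ x • (γ + ∫ s in 0..x, g s))
      (g := fun x => φ x • g x) (((hφ.continuous_deriv (by simp)).continuousOn.smul
      (continuousOn_primitive γ hg right_mem_uIcc)).intervalIntegrable)
      (hg.continuousOn_smul hφ.continuous.continuousOn), z1, z2, zero_smul, zero_smul, sub_zero] at h
  rw [integral_hist hτ, integral_hist hτ]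
  exact eq_neg_of_add_eq_zero_left h

/-- The lemma of du Bois-Reymond: a function with vanishing weak derivative is constant. -/
theorem ae_eq_const_of_integral_deriv_smul_eq_zero {E : Type*} [NormedAddCommGroup E]
    [NormedSpace ℝ E] [CompleteSpace E] {a b : ℝ} (hab : a < b) {w : ℝ → E}
    (hw : Integrable w (volume.restrict (Ioo a b)))
    (h : ∀ φ : ℝ → ℝ, ContDiff ℝ ∞ φ → HasCompactSupport φ → tsupport φ ⊆ Ioo a b →
      ∫ x, deriv φ x • w x ∂(volume.restrict (Ioo a b)) = 0) :
    ∃ k, w =ᵐ[volume.restrict (Ioo a b)] fun _ => k := by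
  obtain ⟨x₀, hx₀⟩ := nonempty_Ioo.2 hab
  obtain ⟨r, hr, hrs⟩ := Metric.isOpen_iff.1 isOpen_Ioo x₀ hx₀
  let f : ContDiffBump x₀ := ⟨r / 4, r / 2, by positivity, by linarith⟩
  let ψ : ℝ → ℝ := f.normed volume
  have hψ : ContDiff ℝ ∞ ψ := f.contDiff_normed
  have hψc : HasCompactSupport ψ := f.hasCompactSupport_normed
  have hψs : tsupport ψ ⊆ Ioo a b := by
    rw [f.tsupport_normed_eq]
    exact (Metric.closedBall_subset_ball (by simp only [f]; linarith)).trans hrs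
  have hψi : ∫ x, ψ x = 1 := f.integral_normed
  have hint : ∀ φ : ℝ → ℝ, ContDiff ℝ ∞ φ → HasCompactSupport φ →
      Integrable (fun x => φ x • w x) (volume.restrict (Ioo a b)) := fun φ h1 h2 => by
    obtain ⟨K, hK⟩ := h2.exists_bound_of_continuous h1.continuous
    exact hw.bdd_smul K h1.continuous.aestronglyMeasurable (Eventually.of_forall hK)
  -- Since ψ has mass one, testing a constant `w` against ψ returns that constant.
  let k : E := ∫ x, ψ x • w x ∂(volume.restrict (Ioo a b))
  refine ⟨k, ?_⟩
  have key : ∀ φ : ℝ → ℝ, ContDiff ℝ ∞ φ → HasCompactSupport φ → tsupport φ ⊆ Ioo a b →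
      ∫ x, φ x • (w x - k) ∂(volume.restrict (Ioo a b)) = 0 := by
    intro φ h1 h2 h3
    have hφi : ∫ x, φ x = ∫ x in Ioo a b, φ x :=
      (setIntegral_eq_integral_of_forall_compl_eq_zero fun x hx =>
        image_eq_zero_of_notMem_tsupport fun hx' => hx (h3 hx')).symm
    let m : ℝ := ∫ x, φ x
    -- Subtracting the mass of φ leaves a function of mean zero, hence the derivative of a test
    -- function.
    let η : ℝ → ℝ := fun x => φ x - m * ψ x
    have hη : ContDiff ℝ ∞ η := h1.sub (contDiff_const.mul hψ)
    have hηi : Integrable η :=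
      (h1.continuous.integrable_of_hasCompactSupport h2).sub
        ((hψ.continuous.integrable_of_hasCompactSupport hψc).const_mul m)
    have hη0 : ∫ x, η x = 0 := by
      rw [integral_sub (h1.continuous.integrable_of_hasCompactSupport h2)
        ((hψ.continuous.integrable_of_hasCompactSupport hψc).const_mul m), integral_const_mul, hψi]
      simp [m]
    let K := tsupport φ ∪ tsupport ψ
    have hK : IsCompact K := h2.union hψc
    have hKne : K.Nonempty := by
      by_contra! hne
      have : ψ = 0 := by
        rw [← tsupport_eq_empty_iff]
        exact (union_empty_iff.1 hne).2
      simp [this] at hψi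
    have hKs : K ⊆ Ioo a b := union_subset h3 hψs
    have ha' := hKs (hK.sInf_mem hKne)
    have hb' := hKs (hK.sSup_mem hKne)
    have hKI : K ⊆ Icc (sInf K) (sSup K) := fun x hx =>
      ⟨csInf_le hK.bddBelow hx, le_csSup hK.bddAbove hx⟩
    have hηz : ∀ x, x ∉ Icc (sInf K) (sSup K) → η x = 0 := fun x hx => by
      have hx' : x ∉ K := fun h => hx (hKI h)
      have e1 : φ x = 0 := image_eq_zero_of_notMem_tsupport fun h => hx' (Or.inl h)
      have e2 : ψ x = 0 := image_eq_zero_of_notMem_tsupport fun h => hx' (Or.inr h)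
      simp [η, e1, e2]
    -- Integrating from -∞ makes Θ vanish to the left of `K`; the zero mean of η makes it vanish to
    -- the right.
    let Θ : ℝ → ℝ := fun x => ∫ s in Iic x, η s
    have hΘ : ∀ x, HasDerivAt Θ (η x) x := fun x => by
      have e : Θ = fun y => (∫ s in Iic a, η s) + ∫ s in a..y, η s := by
        funext y
        rw [← intervalIntegral.integral_Iic_sub_Iic hηi.integrableOn hηi.integrableOn,
          add_sub_cancel]
      rw [e]
      exact (intervalIntegral.integral_hasDerivAt_right (hη.continuous.intervalIntegrable _ _)
        (hη.continuous.stronglyMeasurableAtFilter _ _) hη.continuous.continuousAt).const_add _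
    have hΘd : deriv Θ = η := funext fun x => (hΘ x).deriv
    have hΘc : ContDiff ℝ ∞ Θ := by
      rw [contDiff_infty_iff_deriv, hΘd]
      exact ⟨fun x => (hΘ x).differentiableAt, hη⟩
    have hΘs : tsupport Θ ⊆ Icc (sInf K) (sSup K) := by
      refine closure_minimal (fun x hx => ?_) isClosed_Icc
      by_contra hn
      refine hx ?_
      rw [mem_Icc, not_and_or, not_le, not_le] at hn
      rcases hn with hn | hn
      · refine setIntegral_eq_zero_of_forall_eq_zero fun s hs => hηz s fun hs' => ?_
        exact absurd (hs'.1.trans hs) (not_le.2 hn)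
      · rw [← hη0]
        refine setIntegral_eq_integral_of_forall_compl_eq_zero fun s hs => hηz s fun hs' => ?_
        exact hs (hs'.2.trans hn.le)
    have := h Θ hΘc (isCompact_Icc.of_isClosed_subset (isClosed_tsupport _) hΘs)
      (hΘs.trans (Icc_subset_Ioo ha'.1 hb'.2))
    rw [hΘd] at this
    have e : ∀ x, η x • w x = φ x • w x - m • (ψ x • w x) := fun x => by
      simp only [η, sub_smul, smul_smul]
    simp only [e] at this
    rw [integral_sub (f := fun x => φ x • w x) (g := fun x => m • (ψ x • w x)) (hint φ h1 h2)
      ((hint ψ hψ hψc).smul m), integral_smul] at this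
    simp only [smul_sub]
    rw [integral_sub (f := fun x => φ x • w x) (g := fun x => φ x • k) (hint φ h1 h2)
      ((h1.continuous.integrable_of_hasCompactSupport h2).integrableOn.smul_const k),
      integral_smul_const, ← hφi]
    exact this
  have hz := isOpen_Ioo.ae_eq_zero_of_integral_contDiff_smul_eq_zero
    (μ := volume.restrict (Ioo a b)) (U := Ioo a b) (f := fun x => w x - k)
    ((hw.sub (integrable_const k)).locallyIntegrable.locallyIntegrableOn _) key
  filter_upwards [hz, ae_restrict_mem measurableSet_Ioo] with x h1 h2
  exact sub_eq_zero.1 (h1 h2)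

end Primitives

/-! ### Dissipativity of the delay operator -/

section Dissipative

variable {τ : ℝ} {d : ℕ}

theorem memLp_of_continuousOn (τ : ℝ) {u : ℝ → Vec d} (hu : ContinuousOn u (Icc (-τ) 0)) :
    MemLp u 2 (wHist τ) := by
  obtain ⟨K, hK⟩ := isCompact_Icc.exists_bound_of_continuousOn hu
  have hm : AEStronglyMeasurable u (hist τ) :=
    (hu.mono Ico_subset_Icc_self).aestronglyMeasurable measurableSet_Ico
  have h : ∀ᵐ θ ∂(hist τ), ‖u θ‖ ≤ K := by
    filter_upwards [ae_restrict_mem measurableSet_Ico] with s hs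
    exact hK s (Ico_subset_Icc_self hs)
  exact MemLp.of_bound (hm.smul_measure _) K (Measure.ae_smul_measure h _)

theorem toLp_ae_hist (hτ : 0 < τ) {u : ℝ → Vec d} (hu : MemLp u 2 (wHist τ)) :
    hu.toLp u =ᵐ[hist τ] u := by
  rw [← ae_wHist hτ]; exact hu.coeFn_toLp

theorem isContRep_toLp (hτ : 0 < τ) {u : ℝ → Vec d} (hu : ContinuousOn u (Icc (-τ) 0)) :
    IsContRep ((memLp_of_continuousOn τ hu).toLp u) u :=
  ⟨hu.mono Ico_subset_Icc_self, toLp_ae_hist hτ _⟩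

theorem intervalIntegrable_histSpace (hτ : 0 < τ) (g : HistSpace τ d) :
    IntervalIntegrable g volume (-τ) 0 :=
  (integrable_hist_iff hτ).1 (integrable_hist hτ g)

/-- The continuous representative of an `H¹` function is a primitive of its weak derivative. -/
theorem eq_primitive_of_hasWeakDeriv (hτ : 0 < τ) {f g : HistSpace τ d} (h : HasWeakDeriv f g)
    {u : ℝ → Vec d} (hu : IsContRep f u) {γ : Vec d} (hγ : Tendsto u (𝓝[<] 0) (𝓝 γ)) :
    ∀ θ ∈ Ico (-τ) 0, u θ = γ + ∫ s in 0..θ, g s := by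
  have hg := intervalIntegrable_histSpace hτ g
  have hI : uIcc (-τ) 0 = Icc (-τ) 0 := uIcc_of_le (by linarith)
  let v : ℝ → Vec d := fun θ => γ + ∫ s in 0..θ, g s
  have hvc : ContinuousOn v (Icc (-τ) 0) := by
    rw [← hI]; exact continuousOn_primitive γ hg right_mem_uIcc
  have hvi : Integrable v (hist τ) :=
    (integrable_hist_iff hτ).2 (by rw [← hI] at hvc; exact hvc.intervalIntegrable)
  have hIoo : hist τ = volume.restrict (Ioo (-τ) 0) :=
    (Measure.restrict_congr_set Ioo_ae_eq_Ico).symm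
  -- f and the primitive v share a weak derivative, so they differ by a constant k almost
  -- everywhere. Continuity makes u = v + k hold everywhere on [-τ, 0), and the limits at 0⁻ force k
  -- = 0.
  obtain ⟨k, hk⟩ := ae_eq_const_of_integral_deriv_smul_eq_zero (a := -τ) (b := 0)
    (w := fun θ => f θ - v θ) (by linarith)
    (by rw [← hIoo]; exact (integrable_hist hτ f).sub hvi) (fun φ h1 h2 h3 => by
      rw [← hIoo]
      have hφ' : Continuous (deriv φ) := h1.continuous_deriv (by simp)
      obtain ⟨K, hK⟩ := h2.deriv.exists_bound_of_continuous hφ'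
      simp only [smul_sub]
      rw [integral_sub (f := fun θ => deriv φ θ • f θ) (g := fun θ => deriv φ θ • v θ)
        (integrable_smul_hist hτ f hφ' h2.deriv)
        (hvi.bdd_smul K hφ'.aestronglyMeasurable (Eventually.of_forall hK)), h φ h1 h2 h3,
        integral_deriv_smul_primitive_of_tsupport hτ γ hg h1 h3, sub_self])
  rw [← hIoo] at hk
  have hae : u =ᵐ[volume.restrict (Ico (-τ) 0)] fun θ => v θ + k := by
    change u =ᵐ[hist τ] _
    filter_upwards [hk, hu.2] with θ h1 h2
    rw [← h2, ← h1]; abel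
  have heq := Measure.eqOn_Ico_of_ae_eq volume hae hu.1
    ((hvc.mono Ico_subset_Icc_self).add continuousOn_const)
  have hlim : Tendsto (fun θ => v θ + k) (𝓝[Ico (-τ) 0] 0) (𝓝 (γ + k)) := by
    have := (hvc 0 (right_mem_Icc.2 (by linarith))).mono_left
      (nhdsWithin_mono (0 : ℝ) (Ico_subset_Icc_self : Ico (-τ) 0 ⊆ Icc (-τ) 0))
    simpa [v] using this.add_const k
  have hnb : 𝓝[Ico (-τ) 0] (0 : ℝ) = 𝓝[<] 0 := nhdsWithin_Ico_eq_nhdsLT (by linarith)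
  rw [hnb] at hlim
  have hlim2 : Tendsto u (𝓝[<] 0) (𝓝 (γ + k)) := by
    refine hlim.congr' ?_
    rw [← hnb]
    filter_upwards [self_mem_nhdsWithin] with θ hθ using (heq hθ).symm
  have hk0 : k = 0 := by simpa using tendsto_nhds_unique hlim2 hγ
  intro θ hθ
  rw [heq hθ]
  simp [hk0, v]

theorem norm_sq_histSpace (hτ : 0 < τ) (f : HistSpace τ d) :
    ‖f‖ ^ 2 = τ⁻¹ * ∫ s, ‖f s‖ ^ 2 ∂(hist τ) := by
  rw [← real_inner_self_eq_norm_sq, L2.inner_def, integral_wHist hτ]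
  simp

theorem norm_sq_kern (C : Kern τ d) : ‖C‖ ^ 2 = ∫ s, ‖C s‖ ^ 2 ∂(hist τ) := by
  rw [Lp.norm_def, (Lp.memLp C).eLpNorm_eq_integral_rpow_norm (by simp) (by simp)]
  have h : 0 ≤ ∫ s, ‖C s‖ ^ 2 ∂(hist τ) := integral_nonneg fun s => by positivity
  simp only [ENNReal.toReal_ofNat, Real.rpow_ofNat]
  rw [ENNReal.toReal_ofReal (by positivity), ← Real.rpow_natCast, ← Real.rpow_mul h]
  simp

/-- Pointwise Young inequality ab ≤ a²/τ + τb²/4 with a = |u(s)| and b = |γ||C(s)|. The weight 1/τ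
is that of the history norm, which thus gets coefficient 1: the leading 1 of ω. -/
theorem inner_integral_kern_le (hτ : 0 < τ) (C : Kern τ d) {f : HistSpace τ d} {u : ℝ → Vec d}
    (hu : IsContRep f u) (γ : Vec d) :
    inner ℝ (∫ s, C s (u s) ∂(hist τ)) γ ≤ ‖f‖ ^ 2 + τ / 4 * ‖C‖ ^ 2 * ‖γ‖ ^ 2 := by
  have hi := integrable_kern hτ C hu
  have hf2 : Integrable (fun s => ‖f s‖ ^ 2) (hist τ) := (memLp_hist hτ f).norm.integrable_sq
  have hC2 : Integrable (fun s => ‖C s‖ ^ 2) (hist τ) := (Lp.memLp C).norm.integrable_sq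
  rw [real_inner_comm, ← integral_inner hi, norm_sq_histSpace hτ, norm_sq_kern,
    ← integral_const_mul, mul_right_comm, ← integral_const_mul,
    ← integral_add (hf2.const_mul _) (hC2.const_mul _)]
  refine integral_mono_ae (hi.const_inner γ) ((hf2.const_mul _).add (hC2.const_mul _)) ?_
  filter_upwards [hu.2] with s hs
  rw [hs]
  have h1 : inner ℝ γ (C s (u s)) ≤ ‖γ‖ * (‖C s‖ * ‖u s‖) :=
    (real_inner_le_norm _ _).trans (by gcongr; exact (C s).le_opNorm _)
  have h2 : τ⁻¹ * ‖u s‖ ^ 2 + τ / 4 * ‖γ‖ ^ 2 * ‖C s‖ ^ 2 - ‖γ‖ * (‖C s‖ * ‖u s‖) =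
      τ⁻¹ * (‖u s‖ - τ / 2 * (‖γ‖ * ‖C s‖)) ^ 2 := by
    field_simp; ring
  have h3 : 0 ≤ τ⁻¹ * (‖u s‖ - τ / 2 * (‖γ‖ * ‖C s‖)) ^ 2 := by positivity
  linarith

/-- The delay operator minus its growth rate is dissipative. -/
theorem inner_le_of_delayRel (hτ : 0 < τ) {LS B : Vec d →L[ℝ] Vec d} {C : Kern τ d}
    {Ψ Φ : State τ d} (h : DelayRel LS B C Ψ Φ) :
    inner ℝ Φ Ψ ≤ growthRate τ LS B C * ‖Ψ‖ ^ 2 := by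
  obtain ⟨hw, u, hu, hlim, hs⟩ := h
  set γ := Ψ.snd
  have hprim := eq_primitive_of_hasWeakDeriv hτ hw hu hlim
  have hg := intervalIntegrable_histSpace hτ Φ.fst
  have henergy : inner ℝ Φ.fst Ψ.fst = τ⁻¹ * ((‖γ‖ ^ 2 - ‖u (-τ)‖ ^ 2) / 2) := by
    have h1 := integral_inner_primitive γ hg (c := 0) right_mem_uIcc
    rw [intervalIntegral.integral_same, add_zero, ← hprim (-τ) ⟨le_rfl, by linarith⟩] at h1
    rw [L2.inner_def, integral_wHist hτ, ← h1, ← integral_hist hτ, smul_eq_mul]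
    congr 1
    refine integral_congr_ae ?_
    filter_upwards [hu.2, ae_restrict_mem measurableSet_Ico] with θ h1 h2
    rw [h1, hprim θ h2]
  have hLS : inner ℝ (LS γ) γ ≤ ‖LS‖ * ‖γ‖ ^ 2 := by
    refine (real_inner_le_norm _ _).trans ?_
    rw [pow_two, ← mul_assoc]
    gcongr
    exact LS.le_opNorm γ
  -- The Young weight is chosen so that the |u(-τ)|² term is cancelled by the boundary term at -τ in
  -- `henergy`.
  have hB : inner ℝ (B (u (-τ))) γ ≤ τ⁻¹ * (‖u (-τ)‖ ^ 2 / 2) + τ / 2 * ‖B‖ ^ 2 * ‖γ‖ ^ 2 := by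
    have h1 : inner ℝ (B (u (-τ))) γ ≤ ‖B‖ * ‖u (-τ)‖ * ‖γ‖ :=
      (real_inner_le_norm _ _).trans (by gcongr; exact B.le_opNorm _)
    have h2 : τ⁻¹ * (‖u (-τ)‖ ^ 2 / 2) + τ / 2 * ‖B‖ ^ 2 * ‖γ‖ ^ 2 - ‖B‖ * ‖u (-τ)‖ * ‖γ‖ =
        τ⁻¹ / 2 * (‖u (-τ)‖ - τ * (‖B‖ * ‖γ‖)) ^ 2 := by
      field_simp; ring
    have h3 : 0 ≤ τ⁻¹ / 2 * (‖u (-τ)‖ - τ * (‖B‖ * ‖γ‖)) ^ 2 := by positivity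
    linarith
  have hC := inner_integral_kern_le hτ C hu γ
  rw [WithLp.prod_inner_apply, WithLp.prod_norm_sq_eq_of_L2]
  change inner ℝ Φ.fst Ψ.fst + inner ℝ Φ.snd γ ≤ growthRate τ LS B C * (‖Ψ.fst‖ ^ 2 + ‖γ‖ ^ 2)
  rw [henergy, hs, delayFunctional, inner_add_left, inner_add_left, growthRate]
  -- The history norm needs only the summand 1 of ω; the other summands are surplus there.
  have hr : 0 ≤ (1 / (2 * τ) + ‖LS‖ + τ / 2 * ‖B‖ ^ 2 + τ / 4 * ‖C‖ ^ 2) * ‖Ψ.fst‖ ^ 2 := by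
    positivity
  have ht : 1 / (2 * τ) * ‖γ‖ ^ 2 = τ⁻¹ * (‖γ‖ ^ 2 / 2) := by field_simp
  nlinarith [sq_nonneg ‖γ‖]

end Dissipative

/-! ### The resolvent of the delay operator -/

section Resolvent

variable {τ : ℝ} {d : ℕ}

/-- The solution of `l u - u' = z` with `u 0 = γ`. -/
noncomputable def resolventSol (l : ℝ) (z : ℝ → Vec d) (γ : Vec d) (θ : ℝ) : Vec d :=
  Real.exp (l * θ) • (γ + ∫ s in 0..θ, -(Real.exp (-(l * s)) • z s))

theorem intervalIntegrable_exp_smul {z : ℝ → Vec d} {p q : ℝ} (l : ℝ)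
    (hz : IntervalIntegrable z volume p q) :
    IntervalIntegrable (fun s => -(Real.exp (-(l * s)) • z s)) volume p q :=
  (hz.continuousOn_smul (by fun_prop)).neg

theorem continuousOn_resolventSol {z : ℝ → Vec d} (l : ℝ) (γ : Vec d)
    (hz : IntervalIntegrable z volume (-τ) 0) (hτ : 0 < τ) :
    ContinuousOn (resolventSol l z γ) (Icc (-τ) 0) := by
  have h := continuousOn_primitive γ (intervalIntegrable_exp_smul l hz) right_mem_uIcc
  rw [uIcc_of_le (by linarith)] at h
  exact (by fun_prop : Continuous fun θ => Real.exp (l * θ)).continuousOn.smul h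

/-- The product rule for e^{lθ} times a primitive, in integrated form. It exhibits l u - z as the
weak derivative of u although z is merely integrable. -/
theorem resolventSol_eq_primitive {z : ℝ → Vec d} (l : ℝ) (γ : Vec d)
    (hz : IntervalIntegrable z volume (-τ) 0) (hτ : 0 < τ) {θ : ℝ} (hθ : θ ∈ Icc (-τ) 0) :
    resolventSol l z γ θ = γ + ∫ s in 0..θ, (l • resolventSol l z γ s - z s) := by
  have hsub : uIcc 0 θ ⊆ uIcc (-τ) 0 := by
    rw [uIcc_of_ge hθ.2, uIcc_of_le (by linarith)]
    exact Icc_subset_Icc_left hθ.1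
  have hF : ContDiff ℝ 1 fun θ : ℝ => Real.exp (l * θ) := by fun_prop
  have h := integral_deriv_smul_primitive hF γ
    ((intervalIntegrable_exp_smul l hz).mono_set hsub) left_mem_uIcc
  have hd : ∀ x, deriv (fun θ : ℝ => Real.exp (l * θ)) x = l * Real.exp (l * x) := fun x => by
    have := ((hasDerivAt_id x).const_mul l).exp.deriv
    simpa [mul_comm] using this
  simp only [hd] at h
  rw [intervalIntegral.integral_same, add_zero, mul_zero, Real.exp_zero, one_smul] at h
  rw [eq_comm, ← eq_sub_iff_add_eq']
  refine Eq.trans ?_ h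
  refine intervalIntegral.integral_congr fun x _ => ?_
  simp only [resolventSol, smul_neg, smul_smul, ← Real.exp_add, add_neg_cancel, Real.exp_zero,
    one_smul, sub_eq_add_neg]

theorem tendsto_of_continuousOn_Icc (hτ : 0 < τ) {u : ℝ → Vec d}
    (hu : ContinuousOn u (Icc (-τ) 0)) : Tendsto u (𝓝[<] 0) (𝓝 (u 0)) := by
  have h := (hu 0 (right_mem_Icc.2 (by linarith))).mono_left
    (nhdsWithin_mono (0 : ℝ) (Ico_subset_Icc_self : Ico (-τ) 0 ⊆ Icc (-τ) 0))
  rwa [nhdsWithin_Ico_eq_nhdsLT (by linarith)] at h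

/-- A pair consisting of a primitive and its derivative belongs to the delay relation. -/
theorem delayRel_resolventSol (hτ : 0 < τ) (LS B : Vec d →L[ℝ] Vec d) (C : Kern τ d)
    {z : ℝ → Vec d} (hz : MemLp z 2 (wHist τ)) (l : ℝ) (γ : Vec d)
    (hu : MemLp (resolventSol l z γ) 2 (wHist τ)) :
    DelayRel LS B C (WithLp.toLp 2 (hu.toLp _, γ))
      (WithLp.toLp 2 (l • hu.toLp _ - hz.toLp z,
        LS γ + delayFunctional B C (resolventSol l z γ))) := by
  have hzi : IntervalIntegrable z volume (-τ) 0 :=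
    (integrable_hist_iff hτ).1 ((integrable_hist hτ (hz.toLp z)).congr (toLp_ae_hist hτ hz))
  have hc := continuousOn_resolventSol l γ hzi hτ
  have hI : uIcc (-τ) 0 = Icc (-τ) 0 := uIcc_of_le (by linarith)
  have hgi : IntervalIntegrable (fun s => l • resolventSol l z γ s - z s) volume (-τ) 0 := by
    refine (ContinuousOn.intervalIntegrable ?_).sub hzi
    rw [hI]; exact hc.const_smul l
  refine ⟨fun φ h1 h2 h3 => ?_, resolventSol l z γ, ⟨hc.mono Ico_subset_Icc_self,
    toLp_ae_hist hτ hu⟩, ?_, rfl⟩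
  · have h := integral_deriv_smul_primitive_of_tsupport hτ γ hgi h1 h3
    refine Eq.trans ?_ (h.trans (congrArg Neg.neg ?_))
    · refine integral_congr_ae ?_
      filter_upwards [toLp_ae_hist hτ hu, ae_restrict_mem measurableSet_Ico] with θ e1 e2
      change deriv φ θ • hu.toLp _ θ = _
      rw [e1, resolventSol_eq_primitive l γ hzi hτ (Ico_subset_Icc_self e2)]
    · refine integral_congr_ae ?_
      have e3 : (l • hu.toLp _ - hz.toLp z : HistSpace τ d) =ᵐ[hist τ]
          fun θ => l • hu.toLp _ θ - hz.toLp z θ := by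
        rw [← ae_wHist hτ]
        filter_upwards [Lp.coeFn_sub (l • hu.toLp _) (hz.toLp z), Lp.coeFn_smul l (hu.toLp _)]
          with θ a b
        rw [a, Pi.sub_apply, b, Pi.smul_apply]
      filter_upwards [toLp_ae_hist hτ hu, toLp_ae_hist hτ hz, e3] with θ e1 e2 e3
      change _ = φ θ • (l • hu.toLp _ - hz.toLp z : HistSpace τ d) θ
      rw [e3, e1, e2]
  · have := tendsto_of_continuousOn_Icc hτ hc
    simpa [resolventSol] using this

theorem delayFunctional_add (hτ : 0 < τ) (B : Vec d →L[ℝ] Vec d) (C : Kern τ d) {u v : ℝ → Vec d}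
    (hu : ContinuousOn u (Icc (-τ) 0)) (hv : ContinuousOn v (Icc (-τ) 0)) :
    delayFunctional B C (u + v) = delayFunctional B C u + delayFunctional B C v := by
  have i := integral_add (integrable_kern hτ C (isContRep_toLp hτ hu))
    (integrable_kern hτ C (isContRep_toLp hτ hv))
  simp only [delayFunctional, Pi.add_apply, map_add, i]
  abel

theorem delayFunctional_smul (B : Vec d →L[ℝ] Vec d) (C : Kern τ d) (c : ℝ) (u : ℝ → Vec d) :
    delayFunctional B C (c • u) = c • delayFunctional B C u := by
  have i := integral_smul (μ := hist τ) c (fun s => C s (u s))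
  simp only [delayFunctional, Pi.smul_apply, map_smul, i, smul_add]

/-- `l - 𝒜` is onto for `l` larger than the growth rate. -/
theorem exists_delayRel_resolvent (hτ : 0 < τ) (LS B : Vec d →L[ℝ] Vec d) (C : Kern τ d) {l : ℝ}
    (hl : growthRate τ LS B C < l) (Z : State τ d) : ∃ Ψ, DelayRel LS B C Ψ (l • Ψ - Z) := by
  have hcont : ∀ (z : HistSpace τ d) (γ : Vec d),
      ContinuousOn (resolventSol l z γ) (Icc (-τ) 0) := fun z γ =>
    continuousOn_resolventSol l γ (intervalIntegrable_histSpace hτ z) hτ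
  have hcont0 : ∀ γ : Vec d, ContinuousOn (resolventSol l 0 γ) (Icc (-τ) 0) := fun γ =>
    continuousOn_resolventSol l γ
      (intervalIntegrable_const : IntervalIntegrable (fun _ => (0 : Vec d)) volume (-τ) 0) hτ
  have happ0 : ∀ (γ : Vec d) θ, resolventSol l 0 γ θ = Real.exp (l * θ) • γ := fun γ θ => by
    simp [resolventSol]
  -- The solution splits as the one with value 0 at θ = 0 plus e^{lθ}γ. `M` is the part of the
  -- present-state equation that is linear in γ.
  let M : Vec d →ₗ[ℝ] Vec d :=
    { toFun := fun γ => l • γ - LS γ - delayFunctional B C (resolventSol l 0 γ)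
      map_add' := fun γ γ' => by
        have e : resolventSol l 0 (γ + γ') = resolventSol l 0 γ + resolventSol l 0 γ' := by
          funext θ; simp [happ0]
        rw [e, delayFunctional_add hτ B C (hcont0 γ) (hcont0 γ'), map_add, smul_add]; abel
      map_smul' := fun c γ => by
        have e : resolventSol l 0 (c • γ) = c • resolventSol l 0 γ := by
          funext θ; simp [happ0, smul_comm c]
        rw [e, delayFunctional_smul, map_smul, RingHom.id_apply, smul_sub, smul_sub, smul_comm] }
  have hM : ∀ γ, M γ = l • γ - LS γ - delayFunctional B C (resolventSol l 0 γ) := fun _ => rfl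
  -- A kernel vector γ makes (e^{lθ}γ, γ) satisfy 𝒜Ψ = lΨ; as l exceeds the growth rate,
  -- dissipativity gives Ψ = 0.
  have hinj : Function.Injective M := by
    rw [injective_iff_map_eq_zero]
    intro γ hγ
    rw [hM, sub_sub, sub_eq_zero] at hγ
    have h := delayRel_resolventSol hτ LS B C MemLp.zero l γ
      (memLp_of_continuousOn τ (hcont0 γ))
    rw [← hγ, MemLp.toLp_zero, sub_zero] at h
    set U := (memLp_of_continuousOn τ (hcont0 γ)).toLp _
    have h2 : inner ℝ (l • (WithLp.toLp 2 (U, γ) : State τ d)) (WithLp.toLp 2 (U, γ)) ≤ _ :=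
      inner_le_of_delayRel hτ h
    rw [real_inner_smul_left, real_inner_self_eq_norm_sq] at h2
    have h3 : ‖(WithLp.toLp 2 (U, γ) : State τ d)‖ ^ 2 ≤ 0 := by
      by_contra! h0
      exact absurd (le_of_mul_le_mul_right h2 h0) (not_le.2 hl)
    have h4 : (WithLp.toLp 2 (U, γ) : State τ d) = 0 := by simpa using h3
    exact congrArg (fun Ψ : State τ d => Ψ.snd) h4
  obtain ⟨γ, hγ⟩ := LinearMap.injective_iff_surjective.1 hinj
    (Z.snd + delayFunctional B C (resolventSol l Z.fst 0))
  have h := delayRel_resolventSol hτ LS B C (Lp.memLp Z.fst) l γ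
      (memLp_of_continuousOn τ (hcont _ γ))
  have e : resolventSol l Z.fst γ = resolventSol l Z.fst 0 + resolventSol l 0 γ := by
    funext θ
    rw [Pi.add_apply, happ0, resolventSol, resolventSol, zero_add, ← smul_add, add_comm]
  have e2 : LS γ + delayFunctional B C (resolventSol l Z.fst γ) = l • γ - Z.snd := by
    rw [e, delayFunctional_add hτ B C (hcont _ _) (hcont0 γ)]
    rw [hM, sub_eq_iff_eq_add] at hγ
    rw [sub_eq_iff_eq_add] at hγ
    rw [hγ]; abel
  rw [e2, Lp.toLp_coeFn] at h
  exact ⟨_, h⟩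

end Resolvent

/-! ### The delay semigroup and the Galerkin semigroups -/

section Generation

variable {τ : ℝ} {d : ℕ}

theorem mem_delayGraph (hτ : 0 < τ) (LS B : Vec d →L[ℝ] Vec d) (C : Kern τ d) (Ψ Φ : State τ d) :
    (Ψ, Φ) ∈ delayGraph hτ LS B C ↔ DelayRel LS B C Ψ Φ := Iff.rfl

theorem exists_delay_semigroup (hτ : 0 < τ) (LS B : Vec d →L[ℝ] Vec d) (C : Kern τ d) :
    ∃ T : ℝ → State τ d →L[ℝ] State τ d,
      IsC0Semigroup T ∧ IsGenerator T (delayOp hτ LS B C) := by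
  obtain ⟨T, hT, hg⟩ := exists_semigroup_of_quasidissipative (P := delayGraph hτ LS B C)
    (c := growthRate τ LS B C) (fun x y h => inner_le_of_delayRel hτ h)
    (fun y h => delayGraph_single hτ LS B C _ h rfl)
    (fun l hl z => exists_delayRel_resolvent hτ LS B C hl z)
  refine ⟨T, hT, fun x y => ?_⟩
  rw [mem_delayOp_graph, ← mem_delayGraph hτ, hg]

theorem growthRate_nonneg (hτ : 0 < τ) (LS B : Vec d →L[ℝ] Vec d) (C : Kern τ d) :
    0 ≤ growthRate τ LS B C := by
  unfold growthRate; positivity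

theorem dense_delayRel_domain (hτ : 0 < τ) (LS B : Vec d →L[ℝ] Vec d) (C : Kern τ d) :
    Dense {Ψ : State τ d | ∃ Φ, DelayRel LS B C Ψ Φ} := by
  exact dense_domain_of_dissipative (P := delayGraph hτ LS B C)
    (fun x y h => inner_le_of_delayRel hτ h) (fun y h => delayGraph_single hτ LS B C _ h rfl)
    (lt_add_one _) (fun z => exists_delayRel_resolvent hτ LS B C (lt_add_one _) z)

theorem norm_delay_semigroup_le (hτ : 0 < τ) (LS B : Vec d →L[ℝ] Vec d) (C : Kern τ d)
    {T : ℝ → State τ d →L[ℝ] State τ d} (hT : IsC0Semigroup T)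
    (hg : IsGenerator T (delayOp hτ LS B C)) {t : ℝ} (ht : 0 ≤ t) :
    ‖T t‖ ≤ Real.exp (growthRate τ LS B C * t) := by
  have h : ∀ x y, DelayRel LS B C x y ↔
      Tendsto (fun h : ℝ => h⁻¹ • (T h x - x)) (𝓝[>] 0) (𝓝 y) := fun x y => by
    rw [← hg x y, mem_delayOp_graph]
  refine hT.norm_le_exp (fun x y hxy => inner_le_of_delayRel hτ ((h x y).2 hxy)) ?_ ht
  simp only [← h]
  exact dense_delayRel_domain hτ LS B C

/-- Self-adjointness moves the outer Π_N onto x, leaving the estimate for 𝒜 at Π_N x. Passing from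
‖Π_N x‖ to ‖x‖ uses ω ≥ 0. -/
theorem galerkinOp_inner_le (hτ : 0 < τ) (LS B : Vec d →L[ℝ] Vec d) (C : Kern τ d) (N : ℕ)
    (x : State τ d) :
    inner ℝ (galerkinOp hτ LS B C N x) x ≤ growthRate τ LS B C * ‖x‖ ^ 2 := by
  let p := (galerkinSpace τ d N).orthogonalProjectionOnto x
  let w : (delayOp hτ LS B C).domain :=
    Submodule.inclusion (galerkinSpace_le_domain hτ LS B C N) p
  have h : DelayRel LS B C (w : State τ d) (delayOp hτ LS B C w) :=
    (mem_delayOp_graph hτ LS B C _ _).1 (LinearPMap.mem_graph _ w)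
  have h1 : inner ℝ (galerkinOp hτ LS B C N x) x =
      inner ℝ (delayOp hτ LS B C w) (w : State τ d) :=
    Submodule.inner_starProjection_left_eq_right _ _ _
  rw [h1]
  refine (inner_le_of_delayRel hτ h).trans ?_
  have h2 : ‖(w : State τ d)‖ ≤ ‖x‖ :=
    (galerkinSpace τ d N).norm_starProjection_apply_le x
  have := growthRate_nonneg hτ LS B C
  gcongr

theorem galerkinOp_apply_sub_proj (hτ : 0 < τ) (LS B : Vec d →L[ℝ] Vec d) (C : Kern τ d) (N : ℕ)
    (x : State τ d) : galerkinOp hτ LS B C N (x - galerkinProj τ d N x) = 0 := by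
  have h : (galerkinSpace τ d N).orthogonalProjectionOnto (x - galerkinProj τ d N x) = 0 := by
    rw [Submodule.orthogonalProjectionOnto_eq_zero_iff]
    exact Submodule.sub_starProjection_mem_orthogonal x
  simp [galerkinOp, h]

theorem exp_smul_apply_of_apply_eq_zero {X : Type*} [NormedAddCommGroup X] [NormedSpace ℝ X]
    [CompleteSpace X] {A : X →L[ℝ] X} {x : X} (hx : A x = 0) (t : ℝ) :
    NormedSpace.exp (t • A) x = x := by
  have h : ∀ s, HasDerivAt (fun s : ℝ => NormedSpace.exp (s • A) x) 0 s := fun s => by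
    simpa [hx] using hasDerivAt_exp_smul_apply A x s
  have := is_const_of_deriv_eq_zero (fun s => (h s).differentiableAt) (fun s => (h s).deriv) t 0
  simpa using this

theorem exp_smul_apply_apply {X : Type*} [NormedAddCommGroup X] [NormedSpace ℝ X]
    [CompleteSpace X] (A : X →L[ℝ] X) (t : ℝ) (x : X) :
    NormedSpace.exp (t • A) (A x) = A (NormedSpace.exp (t • A) x) := by
  have h : Commute A (NormedSpace.exp (t • A)) := ((Commute.refl A).smul_right t).exp_right
  exact (congrArg (fun L : X →L[ℝ] X => L x) h.eq).symm

/-- 𝒜_N kills the range of I - Π_N, so its exponential is the identity there and absorbs the second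
summand of T_N(t). -/
theorem galerkinFlow_eq_exp (hτ : 0 < τ) (LS B : Vec d →L[ℝ] Vec d) (C : Kern τ d) (N : ℕ) :
    galerkinFlow hτ LS B C N = fun t => NormedSpace.exp (t • galerkinOp hτ LS B C N) := by
  funext t
  ext1 x
  have h := exp_smul_apply_of_apply_eq_zero (galerkinOp_apply_sub_proj hτ LS B C N x) t
  rw [map_sub, sub_eq_iff_eq_add] at h
  rw [h]
  simp [galerkinFlow, add_comm]

theorem map_exp_smul_apply_of_comp_eq_zero {X : Type*} [NormedAddCommGroup X] [NormedSpace ℝ X]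
    [CompleteSpace X] {A Q : X →L[ℝ] X} (h : ∀ x, Q (A x) = 0) (t : ℝ) (u : X) :
    Q (NormedSpace.exp (t • A) u) = Q u := by
  have hd : ∀ s, HasDerivAt (fun s : ℝ => Q (NormedSpace.exp (s • A) u)) 0 s := fun s => by
    have h1 := Q.hasFDerivAt.comp_hasDerivAt s (hasDerivAt_exp_smul_apply A u s)
    rwa [exp_smul_apply_apply, h] at h1
  have := is_const_of_deriv_eq_zero (fun s => (hd s).differentiableAt) (fun s => (hd s).deriv) t 0
  simpa using this

/-- With Q the projection onto the orthogonal complement of `K`, QA = 0 makes Q e^{tA}u constant in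
t, hence equal to Qu = 0. -/
theorem exp_smul_apply_mem {X : Type*} [NormedAddCommGroup X] [InnerProductSpace ℝ X]
    [CompleteSpace X] {A : X →L[ℝ] X} {K : Submodule ℝ X} [K.HasOrthogonalProjection]
    (hA : ∀ x, A x ∈ K) (t : ℝ) {u : X} (hu : u ∈ K) : NormedSpace.exp (t • A) u ∈ K := by
  have hQ : ∀ x, (ContinuousLinearMap.id ℝ X - K.starProjection) x = 0 ↔ x ∈ K := fun x => by
    rw [← Submodule.starProjection_eq_self_iff, eq_comm (a := K.starProjection x)]
    exact sub_eq_zero (a := x) (b := K.starProjection x)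
  rw [← hQ, map_exp_smul_apply_of_comp_eq_zero fun x => (hQ _).2 (hA x)]
  exact (hQ u).2 hu

theorem galerkinOp_mem (hτ : 0 < τ) (LS B : Vec d →L[ℝ] Vec d) (C : Kern τ d) (N : ℕ)
    (x : State τ d) : galerkinOp hτ LS B C N x ∈ galerkinSpace τ d N := by
  rw [galerkinOp, ContinuousLinearMap.comp_apply, galerkinProj]
  exact Submodule.starProjection_apply_mem _ _

theorem exp_galerkinOp_mem (hτ : 0 < τ) (LS B : Vec d →L[ℝ] Vec d) (C : Kern τ d) (N : ℕ)
    (t : ℝ) {u : State τ d} (hu : u ∈ galerkinSpace τ d N) :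
    NormedSpace.exp (t • galerkinOp hτ LS B C N) u ∈ galerkinSpace τ d N := by
  have h := galerkinOp_mem hτ LS B C N
  generalize galerkinOp hτ LS B C N = A at h ⊢
  exact exp_smul_apply_mem h t hu

end Generation

end DelayGalerkin
theorem mainTheorem7 (d : ℕ) (hd : 1 ≤ d) (τ : ℝ) (hτ : 0 < τ)
    (LS B : DelayGalerkin.Vec d →L[ℝ] DelayGalerkin.Vec d) (C : DelayGalerkin.Kern τ d) :
    -- `𝒜` generates a `C₀`-semigroup
    (∃ T : ℝ → DelayGalerkin.State τ d →L[ℝ] DelayGalerkin.State τ d,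
      DelayGalerkin.IsC0Semigroup T ∧
      DelayGalerkin.IsGenerator T (DelayGalerkin.delayOp hτ LS B C)) ∧
    -- the semigroup generated by `𝒜` satisfies the growth bound
    (∀ T : ℝ → DelayGalerkin.State τ d →L[ℝ] DelayGalerkin.State τ d,
      DelayGalerkin.IsC0Semigroup T →
      DelayGalerkin.IsGenerator T (DelayGalerkin.delayOp hτ LS B C) →
      ∀ t : ℝ, 0 ≤ t → ‖T t‖ ≤ Real.exp (DelayGalerkin.growthRate τ LS B C * t)) ∧
    -- each `T_N` is a `C₀`-semigroup generated by `𝒜_N` that extends the flow of `𝒜_N` on `ℋ_N`,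
    -- with the same growth bound for all `N`
    ∀ N : ℕ,
      DelayGalerkin.IsC0Semigroup (DelayGalerkin.galerkinFlow hτ LS B C N) ∧
      DelayGalerkin.IsGenerator (DelayGalerkin.galerkinFlow hτ LS B C N)
        ((DelayGalerkin.galerkinOp hτ LS B C N).toLinearMap.toPMap ⊤) ∧
      (∀ t : ℝ, 0 ≤ t → ∀ u ∈ DelayGalerkin.galerkinSpace τ d N,
        DelayGalerkin.galerkinFlow hτ LS B C N t u =
            NormedSpace.exp (t • DelayGalerkin.galerkinOp hτ LS B C N) u ∧
          DelayGalerkin.galerkinFlow hτ LS B C N t u ∈ DelayGalerkin.galerkinSpace τ d N) ∧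
      ∀ t : ℝ, 0 ≤ t →
        ‖DelayGalerkin.galerkinFlow hτ LS B C N t‖ ≤
          Real.exp (DelayGalerkin.growthRate τ LS B C * t) := by
  refine ⟨DelayGalerkin.exists_delay_semigroup hτ LS B C,
    fun T hT hg t ht => DelayGalerkin.norm_delay_semigroup_le hτ LS B C hT hg ht, fun N => ?_⟩
  rw [DelayGalerkin.galerkinFlow_eq_exp]
  exact ⟨DelayGalerkin.isC0Semigroup_exp _, DelayGalerkin.isGenerator_exp _,
    fun t _ u hu => ⟨rfl, DelayGalerkin.exp_galerkinOp_mem hτ LS B C N t hu⟩,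
    fun t ht => DelayGalerkin.norm_exp_smul_le (DelayGalerkin.galerkinOp_inner_le hτ LS B C N) ht⟩
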